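/- **Setting.** Let $Q$ be a smooth finite-dimensional manifold with cotangent bundle $\pi_Q:T^*Q\to Q$, and let $B$ be a Poisson tensor on $T^*Q$, with $B(\alpha,\beta)=\langle\alpha,B^\sharp\beta\rangle$ and $\{f,g\}_B=B(\mathrm df,\mathrm dg)$. Let a Lie group $G$ act smoothly on $Q$ such that the cotangent lifted action $\Phi$ on $T^*Q$ preserves $B$. Let $H:T^*Q\to\mathbb R$ be a smooth $G$-invariant function, $F:T^*Q\to T^*Q$ a smooth fiber-preserving $G$-equivariant map, and $W\subset T^*Q$ a $G$-invariant embedded submanifold, with the relative topology (no further condition on the intersections of $W$ with the fibers is needed). Then $(T^*Q,G,B,H,F,W)$ is called a *symmetric CH system*. Fix a splitting of $TT^*Q$ into the vertical bundle $\ker T\pi_Q$ and a horizontal bundle. For a fiber-preserving map $u$ let $\mathrm{vlift}(u)(a)\in T_a(T^*Q)$ be the vertical part of $Tu(X_H(a))$, translated along the fiber from $u(a)$ to $a$, where $X_H=B^\sharp\mathrm dH$. A control law is a smooth fiber-preserving map $u:T^*Q\to W$; its closed-loop dynamics is $X_H+\mathrm{vlift}(F)+\mathrm{vlift}(u)$.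 Assume that $W$ is a *controllability submanifold*: any two points of $T^*Q$ are joined by a continuous curve $x:[0,1]\to T^*Q$ made of finitely many smooth pieces, each an integral curve of the closed-loop dynamics of some control law. Let $D^G\subset TT^*Q|_W$ be a *$G$-invariant controllability distribution*: a family of subspaces $D^G(z)\subset T_z(T^*Q)$, $z\in W$, with $T\Phi_g D^G(z)=D^G(\Phi_g(z))$, which is *Poisson* (if $f,g\in C^\infty(U)$, $U\subset T^*Q$ open, and $\mathrm df,\mathrm dg$ vanish on $D^G$ along $U\cap W$, then so does $\mathrm d\{f,g\}_B$) and such that $D_W=D^G\cap TW$ is smooth and integrable. Assume moreover that $D_W$ is regular, i.e. of locally constant rank. Let $\pi:W\to W/D_W$ be the projection to the space of maximal integral manifolds (accessible sets) of $D_W$, with the quotient topology. A subset of $W$ is *$D_W$-invariant* if it is invariant under the flows of all local sections of $D_W$; a subset $V\subset W/D_W$ is called $G$-invariant if $\pi^{-1}(V)$ is. $C^\infty(U)^G$ denotes the smooth functions $K$ on an open $G$-invariant set $U\subset T^*Q$ with $K\circ\Phi_g=K$ for all $g\in G$. For $V\subset W/D_W$ open and $G$-invariant and $k:V\to\mathbb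 R$, a *local extension* of $k\circ\pi$ at $m\in\pi^{-1}(V)$ is a function $K\in C^\infty(U_m)^G$ on an open $G$-invariant neighborhood $U_m$ of $m$ in $T^*Q$ such that $U_m\cap W$ is $D_W$-invariant and $K=k\circ\pi$ on $\pi^{-1}(V)\cap U_m$. It is *$D^G$-invariant* if in addition $\mathrm dK(y)|_{D^G(y)}=0$ for all $y\in\pi^{-1}(V)\cap U_m$. Let $C^\infty_{W/D_W}(V)$ be the set of those $k$ such that every point of $V$ is $\pi(m)$ for some $m$ at which $k\circ\pi$ has a local extension. Assume the *$(D^G,D_W)$-local extension property*: for all $V$ and all $k\in C^\infty_{W/D_W}(V)$, every point of $V$ is $\pi(m)$ for some $m$ at which $k\circ\pi$ has a local $D^G$-invariant extension. The system is *Poisson reducible by $D^G$* if there are brackets making $V\mapsto C^\infty_{W/D_W}(V)$ ($V$ open and $G$-invariant) a presheaf of Poisson algebras such that $$\{k,l\}_V(\pi(m))=\{K,L\}_B(m)$$ for all $k,l\in C^\infty_{W/D_W}(V)$, all $m\in\pi^{-1}(V)$ and all local $D^G$-invariant extensions $K,L\in C^\infty(U_m)^G$ of $k\circ\pi$, $l\circ\pi$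 at $m$. **Theorem 4.3.** Under these assumptions the symmetric CH system is Poisson reducible by $D^G$ if and only if $$B^\sharp(\Delta^G_z)\subset(\Delta^G_z)_W^\circ\qquad\text{for all }z\in W.$$ Here $\Delta^G_z$ is the set of all $\mathrm df(z)$ with $f\in C^\infty(U_z)^G$, $U_z$ an open $G$-invariant neighborhood of $z$ in $T^*Q$, and $\mathrm df(y)|_{D^G(y)}=0$ for all $y\in U_z\cap W$; $(\Delta^G_z)_W$ is the set of those $\mathrm df(z)$ for which $f$ is moreover constant on $U_z\cap W$; and $A^\circ=\{v\in T_z(T^*Q):\langle\alpha,v\rangle=0\ \forall\alpha\in A\}$. -/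

import Mathlib

open scoped Manifold ContDiff Topology
open Bundle Set

noncomputable section

namespace CHSystems

/-! ### Poisson structures, distributions and leaf spaces on general manifolds -/

section General

variable {EP : Type*} [NormedAddCommGroup EP] [NormedSpace ℝ EP]
  {HP : Type*} [TopologicalSpace HP] {I : ModelWithCorners ℝ EP HP}
  {P : Type*} [TopologicalSpace P] [ChartedSpace HP P]
  {EW : Type*} [NormedAddCommGroup EW] [NormedSpace ℝ EW]
  {W : Type*} [TopologicalSpace W] [ChartedSpace EW W]

variable (I) in
/-- The differential `df(z)` of a real function, as a covector at `z`. -/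
def dAt (f : P → ℝ) (z : P) : TangentSpace I z →L[ℝ] ℝ :=
  mfderiv I 𝓘(ℝ, ℝ) f z

variable (I P) in
/-- A Poisson structure on the (finite-dimensional) manifold `P`, given by the bundle map
`B♯ : T*P → TP` of its Poisson tensor `B(α, β) = ⟨α, B♯ β⟩`.  The tensor is antisymmetric, smooth
(brackets of smooth functions are smooth), and its bracket satisfies the Jacobi identity.
Bilinearity and the derivation property hold because the bracket of `f` and `g` is
`B(df, dg)`. -/
structure PoissonStructure where
  /-- the bundle map `B♯` -/
  sharp : ∀ z : P, (TangentSpace I z →L[ℝ] ℝ) →ₗ[ℝ] TangentSpace I z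
  skew : ∀ z (α β : TangentSpace I z →L[ℝ] ℝ), α (sharp z β) = - β (sharp z α)
  smooth : ∀ U : Set P, IsOpen U → ∀ f g : P → ℝ,
    ContMDiffOn I 𝓘(ℝ, ℝ) ∞ f U → ContMDiffOn I 𝓘(ℝ, ℝ) ∞ g U →
    ContMDiffOn I 𝓘(ℝ, ℝ) ∞ (fun z => dAt I f z (sharp z (dAt I g z))) U
  jacobi : ∀ U : Set P, IsOpen U → ∀ f g h : P → ℝ,
    ContMDiffOn I 𝓘(ℝ, ℝ) ∞ f U → ContMDiffOn I 𝓘(ℝ, ℝ) ∞ g U →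
    ContMDiffOn I 𝓘(ℝ, ℝ) ∞ h U → ∀ z ∈ U,
    dAt I f z (sharp z (dAt I (fun y => dAt I g y (sharp y (dAt I h y))) z)) +
    dAt I g z (sharp z (dAt I (fun y => dAt I h y (sharp y (dAt I f y))) z)) +
    dAt I h z (sharp z (dAt I (fun y => dAt I f y (sharp y (dAt I g y))) z)) = 0

namespace PoissonStructure

/-- The Poisson tensor `B(α, β) = ⟨α, B♯ β⟩`. -/
def tensor (B : PoissonStructure I P) (z : P) (α β : TangentSpace I z →L[ℝ] ℝ) : ℝ :=
  α (B.sharp z β)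

/-- The Poisson bracket `{f, g}(z) = B(z)(df(z), dg(z))`. -/
def bracket (B : PoissonStructure I P) (f g : P → ℝ) : P → ℝ :=
  fun z => B.tensor z (dAt I f z) (dAt I g z)

/-- A smooth self-map is Poisson if it preserves the Poisson tensor, equivalently if
`{f ∘ φ, g ∘ φ} = {f, g} ∘ φ`. -/
def IsPoissonMap (B : PoissonStructure I P) (φ : P → P) : Prop :=
  ContMDiff I I ∞ φ ∧
  ∀ (z : P) (α β : TangentSpace I (φ z) →L[ℝ] ℝ),
    B.tensor z (α.comp (mfderiv I I φ z)) (β.comp (mfderiv I I φ z)) = B.tensor (φ z) α β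

end PoissonStructure

/-! #### Generalized distributions -/

variable [IsManifold 𝓘(ℝ, EW) ∞ W]

/-- A smooth section over the open set `O` of a generalized distribution. -/
def IsLocalSection (D : ∀ n : W, Submodule ℝ (TangentSpace 𝓘(ℝ, EW) n)) (O : Set W)
    (X : ∀ n : W, TangentSpace 𝓘(ℝ, EW) n) : Prop :=
  IsOpen O ∧
  ContMDiffOn 𝓘(ℝ, EW) 𝓘(ℝ, EW).tangent ∞ (fun n => (⟨n, X n⟩ : TangentBundle 𝓘(ℝ, EW) W)) O ∧
  ∀ n ∈ O, X n ∈ D n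

/-- Smooth (differentiable) generalized distributions. -/
def IsSmoothDistribution (D : ∀ n : W, Submodule ℝ (TangentSpace 𝓘(ℝ, EW) n)) : Prop :=
  ∀ n, ∀ v ∈ D n, ∃ O X, n ∈ O ∧ IsLocalSection D O X ∧ X n = v

/-- Regular distributions: the rank is locally constant. -/
def IsRegularDistribution (D : ∀ n : W, Submodule ℝ (TangentSpace 𝓘(ℝ, EW) n)) : Prop :=
  ∀ n, ∀ᶠ n' in 𝓝 n, Module.finrank ℝ (D n') = Module.finrank ℝ (D n)

/-- (Completely) integrable distributions: through every point passes a connected, injectively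
immersed integral manifold `j : L → W` that is everywhere of maximal dimension, `T L = D`. -/
def IsIntegrableDistribution.{u} {W : Type u} [TopologicalSpace W] [ChartedSpace EW W]
    (D : ∀ n : W, Submodule ℝ (TangentSpace 𝓘(ℝ, EW) n)) : Prop :=
  ∀ n, ∃ (k : ℕ) (L : Type u) (_ : TopologicalSpace L)
    (_ : ChartedSpace (EuclideanSpace ℝ (Fin k)) L) (_ : IsManifold (𝓡 k) ∞ L)
    (_ : ConnectedSpace L) (j : L → W),
    Manifold.IsImmersion (𝓡 k) 𝓘(ℝ, EW) ∞ j ∧ Function.Injective j ∧ n ∈ range j ∧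
    ∀ l, LinearMap.range (mfderiv (𝓡 k) 𝓘(ℝ, EW) j l).toLinearMap = D (j l)

/-- `a` and `b` lie on one integral curve of a local section of `D`. -/
def FlowStep (D : ∀ n : W, Submodule ℝ (TangentSpace 𝓘(ℝ, EW) n)) (a b : W) : Prop :=
  ∃ (O : Set W) (X : ∀ n : W, TangentSpace 𝓘(ℝ, EW) n) (γ : ℝ → W) (s t : ℝ),
    IsLocalSection D O X ∧ (∀ r ∈ uIcc s t, γ r ∈ O) ∧
    IsMIntegralCurveOn (I := 𝓘(ℝ, EW)) γ X (uIcc s t) ∧ γ s = a ∧ γ t = b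

/-- `A` is invariant under the flows of all local sections of `D`. -/
def IsFlowInvariant (D : ∀ n : W, Submodule ℝ (TangentSpace 𝓘(ℝ, EW) n)) (A : Set W) : Prop :=
  ∀ a b, FlowStep D a b → a ∈ A → b ∈ A

/-- The leaf space `W / D`: the points of `W` modulo the accessible sets of `D`, that is, two
points are identified if finitely many integral curves of sections of `D` join them.  For an
integrable `D` these classes are the maximal integral manifolds.  It carries the quotient
topology, and the projection is `Quot.mk _`. -/
abbrev LeafSpace (D : ∀ n : W, Submodule ℝ (TangentSpace 𝓘(ℝ, EW) n)) : Type _ :=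
  Quot (FlowStep D)

/-- The projection `π : W → W / D`. -/
def leafProj (D : ∀ n : W, Submodule ℝ (TangentSpace 𝓘(ℝ, EW) n)) (n : W) : LeafSpace D :=
  Quot.mk _ n

theorem FlowStep.symm {D : ∀ n : W, Submodule ℝ (TangentSpace 𝓘(ℝ, EW) n)} {a b : W}
    (h : FlowStep D a b) : FlowStep D b a := by
  obtain ⟨O, X, γ, s, t, h1, h2, h3, h4, h5⟩ := h
  exact ⟨O, X, γ, t, s, h1, uIcc_comm s t ▸ h2, uIcc_comm s t ▸ h3, h5, h4⟩

theorem IsFlowInvariant.mem_of_leafProj_eq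
    {D : ∀ n : W, Submodule ℝ (TangentSpace 𝓘(ℝ, EW) n)} {A : Set W} (hA : IsFlowInvariant D A)
    {a b : W} (h : leafProj D a = leafProj D b) (ha : a ∈ A) : b ∈ A := by
  have key : ∀ a b, Relation.EqvGen (FlowStep D) a b → (a ∈ A ↔ b ∈ A) := by
    intro a b hab
    induction hab with
    | rel a b hab => exact ⟨hA a b hab, hA b a hab.symm⟩
    | refl a => exact Iff.rfl
    | symm a b _ ih => exact ih.symm
    | trans a b c _ _ ih1 ih2 => exact ih1.trans ih2
  exact (key a b (Quot.eqvGen_exact h)).1 ha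

/-! #### Distributions along a submanifold

The submanifold is a smooth embedding `ι : W → P`.  A generalized distribution in `TP|_W` is a
family `D z ⊆ T_z P`; only its values at the points `z` of `range ι` are ever used. -/

/-- The induced distribution `D_W = D ∩ TW` on `W`. -/
def restrictDist (ι : W → P) (D : ∀ z : P, Submodule ℝ (TangentSpace I z)) :
    ∀ n : W, Submodule ℝ (TangentSpace 𝓘(ℝ, EW) n) :=
  fun n => (D (ι n)).comap (mfderiv 𝓘(ℝ, EW) I ι n).toLinearMap

/-- `dF` vanishes on `D` at all points of `A ∩ U`, where `A` is a subset of the submanifold. -/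
def KillsOn (ι : W → P) (D : ∀ z : P, Submodule ℝ (TangentSpace I z)) (F : P → ℝ) (A : Set W)
    (U : Set P) : Prop :=
  ∀ n ∈ A, ι n ∈ U → ∀ v ∈ D (ι n), dAt I F (ι n) v = 0

/-- `D` is Poisson (canonical): if smooth functions `f`, `g` on an open subset `U` of `P` satisfy
`df|_D = dg|_D = 0`, then `d{f, g}|_D = 0`. -/
def IsPoissonDistribution (B : PoissonStructure I P) (ι : W → P)
    (D : ∀ z : P, Submodule ℝ (TangentSpace I z)) : Prop :=
  ∀ (U : Set P) (f g : P → ℝ), IsOpen U →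
    ContMDiffOn I 𝓘(ℝ, ℝ) ∞ f U → ContMDiffOn I 𝓘(ℝ, ℝ) ∞ g U →
    KillsOn ι D f univ U → KillsOn ι D g univ U → KillsOn ι D (B.bracket f g) univ U

/-! #### Group actions

`Φ g : P → P` is the action of `g` on `P`. -/

variable {G : Type*}

/-- `G`-invariant subsets.  (For a group action this says `Φ_g(A) = A` for all `g`.) -/
def IsGInvariantSet (Φ : G → P → P) (A : Set P) : Prop :=
  ∀ g, ∀ z ∈ A, Φ g z ∈ A

/-- `G`-invariant distributions along the submanifold: `TΦ_g D(z) = D(Φ_g z)`. -/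
def IsGInvariantDistribution (Φ : G → P → P) (ι : W → P)
    (D : ∀ z : P, Submodule ℝ (TangentSpace I z)) : Prop :=
  ∀ g n, (D (ι n)).map (mfderiv I I (Φ g) (ι n)).toLinearMap = D (Φ g (ι n))

variable (I) in
/-- `F ∈ C^∞(U)^G` for an open `G`-invariant set `U`. -/
structure IsInvariantSmoothOn (Φ : G → P → P) (U : Set P) (F : P → ℝ) : Prop where
  isOpen : IsOpen U
  invariant : IsGInvariantSet Φ U
  smooth : ContMDiffOn I 𝓘(ℝ, ℝ) ∞ F U
  comp_eq : ∀ g, ∀ z ∈ U, F (Φ g z) = F z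

/-- `Δ^G_z`: the differentials at `z` of `G`-invariant smooth functions `f` on open `G`-invariant
neighbourhoods `U` of `z` such that `df|_D = 0` on `U ∩ W`. -/
def invCodist (Φ : G → P → P) (ι : W → P) (D : ∀ z : P, Submodule ℝ (TangentSpace I z))
    (z : P) : Set (TangentSpace I z →L[ℝ] ℝ) :=
  {α | ∃ (U : Set P) (f : P → ℝ), z ∈ U ∧ IsInvariantSmoothOn I Φ U f ∧
    KillsOn ι D f univ U ∧ α = dAt I f z}

/-- `(Δ^G_z)_W`: the elements `df(z)` of `Δ^G_z` such that in addition `f` is constant on `U ∩ W`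
for some open `G`-invariant neighbourhood `U` of `z`. -/
def invCodistConst (Φ : G → P → P) (ι : W → P) (D : ∀ z : P, Submodule ℝ (TangentSpace I z))
    (z : P) : Set (TangentSpace I z →L[ℝ] ℝ) :=
  {α | ∃ (U : Set P) (f : P → ℝ), z ∈ U ∧ IsInvariantSmoothOn I Φ U f ∧
    KillsOn ι D f univ U ∧ (∃ c, ∀ n, ι n ∈ U → f (ι n) = c) ∧ α = dAt I f z}

/-- The annihilator in `T_z P` of a set of covectors at `z`. -/
def annihilatorOf {z : P} (A : Set (TangentSpace I z →L[ℝ] ℝ)) : Set (TangentSpace I z) :=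
  {v | ∀ α ∈ A, α v = 0}

/-! #### The presheaf of smooth functions on the leaf space -/

/-- Open `G`-invariant subsets of `W / D_W`: open sets whose preimage in `W` is `G`-invariant. -/
def InvOpens (Φ : G → P → P) (ι : W → P) (D : ∀ z : P, Submodule ℝ (TangentSpace I z)) : Type _ :=
  {V : Set (LeafSpace (restrictDist (EW := EW) ι D)) //
    IsOpen V ∧ IsGInvariantSet Φ (ι '' (leafProj (restrictDist ι D) ⁻¹' V))}

/-- `F ∈ C^∞(U)^G` is a local extension of `f ∘ π`: the open `G`-invariant set `U` meets `W` in a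
`D_W`-invariant set, and `f ∘ π = F` on `π⁻¹(V) ∩ U`. -/
structure IsLocalExtension (Φ : G → P → P) (ι : W → P)
    (D : ∀ z : P, Submodule ℝ (TangentSpace I z))
    (V : Set (LeafSpace (restrictDist (EW := EW) ι D))) (f : V → ℝ)
    (U : Set P) (F : P → ℝ) : Prop where
  inv : IsInvariantSmoothOn I Φ U F
  flow : IsFlowInvariant (restrictDist (EW := EW) ι D) (ι ⁻¹' U)
  eq : ∀ n (hn : leafProj (restrictDist ι D) n ∈ V), ι n ∈ U → F (ι n) = f ⟨_, hn⟩

/-- A local `D`-invariant extension: a local extension `F` of `f ∘ π` with `dF|_D = 0` on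
`π⁻¹(V) ∩ U`. -/
def IsLocalInvariantExtension (Φ : G → P → P) (ι : W → P)
    (D : ∀ z : P, Submodule ℝ (TangentSpace I z))
    (V : Set (LeafSpace (restrictDist (EW := EW) ι D))) (f : V → ℝ)
    (U : Set P) (F : P → ℝ) : Prop :=
  IsLocalExtension Φ ι D V f U F ∧ KillsOn ι D F (leafProj (restrictDist ι D) ⁻¹' V) U

/-- The algebra of smooth functions on `V ⊆ W / D_W`: every point of `V` is the class of a point
at which `f ∘ π` has a local extension. -/
def leafFunctions (Φ : G → P → P) (ι : W → P) (D : ∀ z : P, Submodule ℝ (TangentSpace I z))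
    (V : Set (LeafSpace (restrictDist (EW := EW) ι D))) : Subalgebra ℝ (V → ℝ) where
  carrier := {f | ∀ x ∈ V, ∃ n, leafProj (restrictDist ι D) n = x ∧
    ∃ U F, ι n ∈ U ∧ IsLocalExtension Φ ι D V f U F}
  mul_mem' := by
    intro a b ha hb x hx
    obtain ⟨n, hn, U, F, hU, hF⟩ := ha x hx
    obtain ⟨m, hm, U', F', hU', hF'⟩ := hb x hx
    refine ⟨n, hn, U ∩ U', fun z => F z * F' z, ⟨hU, ?_⟩, ⟨⟨hF.inv.isOpen.inter hF'.inv.isOpen,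
      fun g z hz => ⟨hF.inv.invariant g z hz.1, hF'.inv.invariant g z hz.2⟩, ?_, ?_⟩, ?_, ?_⟩⟩
    · exact hF'.flow.mem_of_leafProj_eq (hm.trans hn.symm) hU'
    · exact (hF.inv.smooth.mono inter_subset_left).mul (hF'.inv.smooth.mono inter_subset_right)
    · intro g z hz
      simp only [hF.inv.comp_eq g z hz.1, hF'.inv.comp_eq g z hz.2]
    · exact fun p q h hp => ⟨hF.flow p q h hp.1, hF'.flow p q h hp.2⟩
    · intro p hp hpU
      simp only [hF.eq p hp hpU.1, hF'.eq p hp hpU.2, Pi.mul_apply]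
  add_mem' := by
    intro a b ha hb x hx
    obtain ⟨n, hn, U, F, hU, hF⟩ := ha x hx
    obtain ⟨m, hm, U', F', hU', hF'⟩ := hb x hx
    refine ⟨n, hn, U ∩ U', fun z => F z + F' z, ⟨hU, ?_⟩, ⟨⟨hF.inv.isOpen.inter hF'.inv.isOpen,
      fun g z hz => ⟨hF.inv.invariant g z hz.1, hF'.inv.invariant g z hz.2⟩, ?_, ?_⟩, ?_, ?_⟩⟩
    · exact hF'.flow.mem_of_leafProj_eq (hm.trans hn.symm) hU'
    · exact (hF.inv.smooth.mono inter_subset_left).add (hF'.inv.smooth.mono inter_subset_right)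
    · intro g z hz
      simp only [hF.inv.comp_eq g z hz.1, hF'.inv.comp_eq g z hz.2]
    · exact fun p q h hp => ⟨hF.flow p q h hp.1, hF'.flow p q h hp.2⟩
    · intro p hp hpU
      simp only [hF.eq p hp hpU.1, hF'.eq p hp hpU.2, Pi.add_apply]
  algebraMap_mem' := by
    intro r x _
    obtain ⟨n, rfl⟩ := Quot.exists_rep x
    exact ⟨n, rfl, univ, fun _ => r, mem_univ _,
      ⟨isOpen_univ, fun _ _ _ => mem_univ _, contMDiffOn_const, fun _ _ _ => rfl⟩,
      fun _ _ _ _ => mem_univ _, fun _ _ _ => rfl⟩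

/-- The restriction maps of the presheaf. -/
def leafRestrict (Φ : G → P → P) (ι : W → P) (D : ∀ z : P, Submodule ℝ (TangentSpace I z))
    {V V' : Set (LeafSpace (restrictDist (EW := EW) ι D))} (h : V' ⊆ V)
    (f : leafFunctions Φ ι D V) : leafFunctions Φ ι D V' :=
  ⟨fun x => f.1 ⟨x.1, h x.2⟩, by
    intro x hx
    obtain ⟨n, hn, U, F, hU, hF⟩ := f.2 x (h hx)
    exact ⟨n, hn, U, F, hU, hF.inv, hF.flow, fun p hp hpU => hF.eq p (h hp) hpU⟩⟩

/-- The local extension property: local extensions can always be chosen `D`-invariant. -/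
def HasLocalExtensionProperty (Φ : G → P → P) (ι : W → P)
    (D : ∀ z : P, Submodule ℝ (TangentSpace I z)) : Prop :=
  ∀ (V : InvOpens (EW := EW) Φ ι D) (f : leafFunctions Φ ι D V.1), ∀ x ∈ V.1,
    ∃ n, leafProj (restrictDist ι D) n = x ∧
      ∃ U F, ι n ∈ U ∧ IsLocalInvariantExtension Φ ι D V.1 f.1 U F

/-- Poisson reducibility: the smooth functions on the leaf space form a presheaf of Poisson
algebras (over the open `G`-invariant sets), with bracket `{k, l}_V(π(n)) = {K, L}_B(n)` for
any local `D`-invariant extensions `K`, `L` of `k ∘ π`, `l ∘ π` at `n`. -/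
def IsPoissonReducible (B : PoissonStructure I P) (Φ : G → P → P) (ι : W → P)
    (D : ∀ z : P, Submodule ℝ (TangentSpace I z)) : Prop :=
  ∃ br : ∀ V : InvOpens (EW := EW) Φ ι D,
      leafFunctions Φ ι D V.1 →ₗ[ℝ] leafFunctions Φ ι D V.1 →ₗ[ℝ] leafFunctions Φ ι D V.1,
    (∀ V k l, br V k l = - br V l k) ∧
    (∀ V k l m, br V k (br V l m) + br V l (br V m k) + br V m (br V k l) = 0) ∧
    (∀ V k l m, br V k (l * m) = br V k l * m + l * br V k m) ∧
    (∀ (V V' : InvOpens (EW := EW) Φ ι D) (h : V'.1 ⊆ V.1) (k l : leafFunctions Φ ι D V.1),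
      leafRestrict Φ ι D h (br V k l) =
        br V' (leafRestrict Φ ι D h k) (leafRestrict Φ ι D h l)) ∧
    (∀ (V : InvOpens (EW := EW) Φ ι D) (k l : leafFunctions Φ ι D V.1) (n : W)
      (hn : leafProj (restrictDist ι D) n ∈ V.1) (U : Set P) (K L : P → ℝ), ι n ∈ U →
      IsLocalInvariantExtension Φ ι D V.1 k.1 U K →
      IsLocalInvariantExtension Φ ι D V.1 l.1 U L →
      (br V k l).1 ⟨_, hn⟩ = B.bracket K L (ι n))

end General

/-! ### Cotangent bundles and controlled Hamiltonian systems -/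

section Cotangent

variable (E : Type*) [NormedAddCommGroup E] [NormedSpace ℝ E]
  {Q : Type*} [TopologicalSpace Q] [ChartedSpace E Q]

/-- The cotangent space `T*_x Q`. -/
abbrev CotangentSpace (x : Q) : Type _ :=
  TangentSpace 𝓘(ℝ, E) x →L[ℝ] Bundle.Trivial Q ℝ x

variable (Q) in
/-- The cotangent bundle `T*Q`. -/
abbrev CotangentBundle : Type _ :=
  TotalSpace (E →L[ℝ] ℝ) (fun x : Q => CotangentSpace E x)

/-- The model with corners of the manifold `T*Q`. -/
abbrev cotModel : ModelWithCorners ℝ (E × (E →L[ℝ] ℝ)) (ModelProd E (E →L[ℝ] ℝ)) :=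
  𝓘(ℝ, E).prod 𝓘(ℝ, E →L[ℝ] ℝ)

variable {E} [IsManifold 𝓘(ℝ, E) ∞ Q]

/-- The vertical lift `d/ds|_{s=0} (a + s β)` in `T_a T*Q` of a covector `β` at the base point
of `a`. -/
def verticalLift (a : CotangentBundle E Q) (β : CotangentSpace E a.proj) :
    TangentSpace (cotModel E) a :=
  (mfderiv 𝓘(ℝ, ℝ) (cotModel E)
    (fun s : ℝ => (⟨a.proj, a.snd + s • β⟩ : CotangentBundle E Q)) 0 (1 : ℝ) :
    E × (E →L[ℝ] ℝ))

variable (E Q) in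
/-- A smooth fiber-preserving map `T*Q → T*Q`. -/
structure FiberMap where
  /-- the map on each fiber -/
  onFiber : ∀ x : Q, CotangentSpace E x → CotangentSpace E x
  smooth : ContMDiff (cotModel E) (cotModel E) ∞
    (fun a : CotangentBundle E Q => (⟨a.proj, onFiber a.proj a.snd⟩ : CotangentBundle E Q))

/-- The underlying map of total spaces. -/
def FiberMap.total (F : FiberMap E Q) (a : CotangentBundle E Q) : CotangentBundle E Q :=
  ⟨a.proj, F.onFiber a.proj a.snd⟩

variable (E Q) in
/-- A splitting `T T*Q = horizontal ⊕ vertical`, as in the definition of vertical parts of tangent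
vectors.  It is given by the map that sends a tangent vector to its vertical part, read as an
element of `T*_x Q` through the vertical lift; the horizontal bundle is the kernel. -/
structure VerticalSplitting where
  /-- the vertical part -/
  vert : ∀ a : CotangentBundle E Q, TangentSpace (cotModel E) a →ₗ[ℝ] CotangentSpace E a.proj
  vert_lift : ∀ a (β : CotangentSpace E a.proj), vert a (verticalLift a β) = β
  smooth : ContMDiff (cotModel E).tangent (cotModel E) ∞
    (fun v : TangentBundle (cotModel E) (CotangentBundle E Q) =>
      (⟨v.proj.proj, vert v.proj v.snd⟩ : CotangentBundle E Q))

/-- `vlift(F) X (a)`: the vertical part of `TF(X(a)) ∈ T_{F(a)} T*Q`, translated along the fiber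
from `F(a)` to `a`. -/
def vlift (𝒜 : VerticalSplitting E Q) (F : FiberMap E Q)
    (X : ∀ a : CotangentBundle E Q, TangentSpace (cotModel E) a) (a : CotangentBundle E Q) :
    TangentSpace (cotModel E) a :=
  verticalLift a (𝒜.vert (F.total a) (mfderiv (cotModel E) (cotModel E) F.total a (X a)))

variable (E Q) in
/-- A CH system `(T*Q, B, H, F, W)`: a Poisson structure on `T*Q`, a Hamiltonian, a force map and
a control subset, which is an embedded submanifold (the image of `ι`). -/
structure CHSystem (EW : Type*) [NormedAddCommGroup EW] [NormedSpace ℝ EW]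
    (W : Type*) [TopologicalSpace W] [ChartedSpace EW W] where
  /-- the Poisson structure on `T*Q` -/
  B : PoissonStructure (cotModel E) (CotangentBundle E Q)
  /-- the Hamiltonian -/
  H : CotangentBundle E Q → ℝ
  H_smooth : ContMDiff (cotModel E) 𝓘(ℝ, ℝ) ∞ H
  /-- the external force map -/
  F : FiberMap E Q
  /-- the inclusion of the control subset -/
  ι : W → CotangentBundle E Q
  ι_embedding : Manifold.IsSmoothEmbedding 𝓘(ℝ, EW) (cotModel E) ∞ ι

namespace CHSystem

variable {EW : Type*} [NormedAddCommGroup EW] [NormedSpace ℝ EW]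
  {W : Type*} [TopologicalSpace W] [ChartedSpace EW W] [IsManifold 𝓘(ℝ, EW) ∞ W]

/-- A control law: a fiber-preserving map from `T*Q` to the control subset. -/
def IsControlLaw (S : CHSystem E Q EW W) (u : FiberMap E Q) : Prop :=
  ∀ a, u.total a ∈ range S.ι

/-- The Hamiltonian vector field `X_H = B♯ dH`. -/
def hamiltonianField (S : CHSystem E Q EW W) (a : CotangentBundle E Q) :
    TangentSpace (cotModel E) a :=
  S.B.sharp a (dAt (cotModel E) S.H a)

/-- The dynamical vector field `X_H + vlift(F) X_H + vlift(u) X_H` of the closed-loop system. -/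
def dynamics (S : CHSystem E Q EW W) (𝒜 : VerticalSplitting E Q) (u : FiberMap E Q)
    (a : CotangentBundle E Q) : TangentSpace (cotModel E) a :=
  S.hamiltonianField a + vlift 𝒜 S.F S.hamiltonianField a + vlift 𝒜 u S.hamiltonianField a

/-- The control subset is a controllability submanifold: any two states `x₀`, `x₁` are joined by
a continuous curve `x : [0, 1] → T*Q` that consists of finitely many smooth pieces, each of which
is an integral curve of the closed-loop dynamics for some control law. -/
def IsControllabilitySubmanifold (S : CHSystem E Q EW W) (𝒜 : VerticalSplitting E Q) : Prop :=
  ∀ x₀ x₁ : CotangentBundle E Q, ∃ (x : ℝ → CotangentBundle E Q) (N : ℕ) (t : ℕ → ℝ),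
    ContinuousOn x (Icc 0 1) ∧ x 0 = x₀ ∧ x 1 = x₁ ∧
    t 0 = 0 ∧ t N = 1 ∧ (∀ i < N, t i < t (i + 1)) ∧
    ∀ i < N, ∃ u, S.IsControlLaw u ∧
      IsMIntegralCurveOn (I := cotModel E) x (S.dynamics 𝒜 u) (Icc (t i) (t (i + 1)))

/-- Controllability distributions: Poisson integrable (smooth) generalized distributions
`D ⊆ T T*Q|_W`, where smoothness and integrability refer to `D_W = D ∩ TW`. -/
def IsControllabilityDistribution (S : CHSystem E Q EW W)
    (D : ∀ z : CotangentBundle E Q, Submodule ℝ (TangentSpace (cotModel E) z)) : Prop :=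
  IsSmoothDistribution (restrictDist (EW := EW) S.ι D) ∧
  IsIntegrableDistribution (restrictDist (EW := EW) S.ι D) ∧
  IsPoissonDistribution S.B S.ι D

end CHSystem

/-- The cotangent lift of an action of `G` on `Q`: `g` sends `α ∈ T*_q Q` to
`α ∘ (T_q Φ_g)⁻¹ ∈ T*_{g q} Q`. -/
def cotangentLift {G : Type*} [SMul G Q] (g : G) (a : CotangentBundle E Q) :
    CotangentBundle E Q :=
  ⟨g • a.proj, a.snd.comp
    (mfderiv 𝓘(ℝ, E) 𝓘(ℝ, E) (fun q : Q => g • q) a.proj).inverse⟩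

variable (G : Type*) [SMul G Q] in
/-- A symmetric CH system: the lifted action is Poisson and `H`, `F`, `W` are `G`-invariant. -/
structure CHSystem.IsSymmetric {EW : Type*} [NormedAddCommGroup EW] [NormedSpace ℝ EW]
    {W : Type*} [TopologicalSpace W] [ChartedSpace EW W] (S : CHSystem E Q EW W) : Prop where
  poisson : ∀ g : G, S.B.IsPoissonMap (cotangentLift g)
  H_inv : ∀ (g : G) a, S.H (cotangentLift g a) = S.H a
  F_inv : ∀ (g : G) a, S.F.total (cotangentLift g a) = cotangentLift g (S.F.total a)
  W_inv : IsGInvariantSet (cotangentLift (E := E) (Q := Q) (G := G)) (range S.ι)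

end Cotangent

end CHSystems

end

open scoped Manifold ContDiff Topology
open Bundle Set

noncomputable section

namespace CHSystems

section General

variable {EP : Type*} [NormedAddCommGroup EP] [NormedSpace ℝ EP]
  {HP : Type*} [TopologicalSpace HP] {I : ModelWithCorners ℝ EP HP}
  {P : Type*} [TopologicalSpace P] [ChartedSpace HP P]
  {EW : Type*} [NormedAddCommGroup EW] [NormedSpace ℝ EW]
  {W : Type*} [TopologicalSpace W] [ChartedSpace EW W]

/-! ### Differentials and brackets -/

/-! Both directions turn on one identity: `{g, f}_B = 0` at `z` whenever `f` and `g` are invariant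
near `z`, their differentials kill `D` along `W`, and `g` is constant on `W`. This is the
annihilator condition paired with `dg(z)`.

If the identity holds, the reduced bracket is the ambient bracket of invariant extensions. Two
extensions of the same function differ by a function that vanishes on `W` and kills `D`, so the
bracket does not depend on the choice (`bracket_eq_of_extensions`). Since `D` is Poisson, `d{K, L}`
kills `D`; hence `{K, L}` is constant on leaves and is itself an invariant extension of the reduced
bracket. The Poisson algebra axioms then descend from the ambient ones.

Conversely, let `n` be a point of `W`. If `D` is nonzero there, the Poisson property of `D` alone
gives the identity (`IsPoissonDistribution.bracket_eq_zero`): for every smooth `h` the function `h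
(g - c)` also kills `D`, and differentiating `{h (g - c), f}` along `v` in `D` leaves only `dh(v)
{g, f}`; choose `h` with `dh(v) ≠ 0`.

If `D_W` is zero at `n`, regularity makes it zero on a clopen invariant part of `W`, where leaves
are points (`IsRegularDistribution.eq_of_leafProj_eq`). There `f` and `g` descend to the leaf space,
and `g` and the constant `c` extend the same function. Reducibility gives `{g, f} = {c, f} = 0`. The
two cases cover everything, because `Tι` is injective and so `D_W ≠ 0` forces `D ≠ 0`. -/

theorem dAt_congr {f g : P → ℝ} {z : P} (h : f =ᶠ[𝓝 z] g) : dAt I f z = dAt I g z :=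
  h.mfderiv_eq

theorem dAt_congr_of_isOpen {f g : P → ℝ} {U : Set P} (hU : IsOpen U) (h : EqOn f g U) {z : P}
    (hz : z ∈ U) : dAt I f z = dAt I g z :=
  dAt_congr (Filter.eventuallyEq_of_mem (hU.mem_nhds hz) h)

theorem dAt_const (c : ℝ) (z : P) : dAt I (fun _ => c) z = 0 :=
  mfderiv_const

theorem dAt_add {f g : P → ℝ} {z : P} (hf : MDifferentiableAt I 𝓘(ℝ, ℝ) f z)
    (hg : MDifferentiableAt I 𝓘(ℝ, ℝ) g z) :
    dAt I (fun y => f y + g y) z = dAt I f z + dAt I g z :=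
  (hf.hasMFDerivAt.add hg.hasMFDerivAt).mfderiv

theorem dAt_sub {f g : P → ℝ} {z : P} (hf : MDifferentiableAt I 𝓘(ℝ, ℝ) f z)
    (hg : MDifferentiableAt I 𝓘(ℝ, ℝ) g z) :
    dAt I (fun y => f y - g y) z = dAt I f z - dAt I g z :=
  (hf.hasMFDerivAt.sub hg.hasMFDerivAt).mfderiv

theorem dAt_mul {f g : P → ℝ} {z : P} (hf : MDifferentiableAt I 𝓘(ℝ, ℝ) f z)
    (hg : MDifferentiableAt I 𝓘(ℝ, ℝ) g z) :
    dAt I (fun y => f y * g y) z = f z • dAt I g z + g z • dAt I f z :=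
  (hf.hasMFDerivAt.mul hg.hasMFDerivAt).mfderiv

theorem dAt_const_mul {f : P → ℝ} {z : P} (c : ℝ) (hf : MDifferentiableAt I 𝓘(ℝ, ℝ) f z) :
    dAt I (fun y => c * f y) z = c • dAt I f z := by
  have h := dAt_mul (f := fun _ => c) mdifferentiableAt_const hf
  rwa [dAt_const, smul_zero, add_zero] at h

theorem mdifferentiableAt_of_isOpen {f : P → ℝ} {U : Set P} (hU : IsOpen U)
    (hf : ContMDiffOn I 𝓘(ℝ, ℝ) ∞ f U) {z : P} (hz : z ∈ U) :
    MDifferentiableAt I 𝓘(ℝ, ℝ) f z :=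
  (hf.contMDiffAt (hU.mem_nhds hz)).mdifferentiableAt (by simp)

theorem dAt_comp {φ : P → P} {f : P → ℝ} {z : P} (hf : MDifferentiableAt I 𝓘(ℝ, ℝ) f (φ z))
    (hφ : MDifferentiableAt I I φ z) :
    dAt I (fun y => f (φ y)) z = (dAt I f (φ z)).comp (mfderiv I I φ z) :=
  (hf.hasMFDerivAt.comp z hφ.hasMFDerivAt).mfderiv

/-- A nonzero tangent vector is detected by a locally defined smooth function. -/
theorem exists_dAt_ne_zero [IsManifold I ∞ P] {z : P} {v : TangentSpace I z} (hv : v ≠ 0) :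
    ∃ (O : Set P) (h : P → ℝ), IsOpen O ∧ z ∈ O ∧ ContMDiffOn I 𝓘(ℝ, ℝ) ∞ h O ∧
      dAt I h z v ≠ 0 := by
  have : IsManifold I 1 P := IsManifold.of_le (n := ∞) (by simp)
  obtain ⟨l, hl⟩ : ∃ l : EP →L[ℝ] ℝ, l v ≠ 0 :=
    SeparatingDual.exists_ne_zero (R := ℝ) (V := EP) hv
  refine ⟨(chartAt HP z).source, fun y => l (extChartAt I z y), (chartAt HP z).open_source,
    mem_chart_source _ _, ?_, ?_⟩
  · exact l.contMDiff.comp_contMDiffOn contMDiffOn_extChartAt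
  -- The tangent space at `z` is read in the preferred chart at `z`, so that chart has the identity
  -- as differential there and `dh(v) = l v`.
  · have h1 : HasMFDerivAt I 𝓘(ℝ, EP) (extChartAt I z) z (ContinuousLinearMap.id ℝ _) := by
      rw [← mfderiv_extChartAt_self]
      exact (mdifferentiableAt_extChartAt (mem_chart_source _ _)).hasMFDerivAt
    have h2 := (l.hasMFDerivAt (x := extChartAt I z z)).comp z h1
    have h3 : dAt I (fun y => l (extChartAt I z y)) z = l.comp (ContinuousLinearMap.id ℝ _) :=
      h2.mfderiv
    rw [h3]
    exact hl

namespace PoissonStructure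

variable (B : PoissonStructure I P)

theorem bracket_apply (f g : P → ℝ) (z : P) :
    B.bracket f g z = dAt I f z (B.sharp z (dAt I g z)) := rfl

theorem bracket_skew (f g : P → ℝ) (z : P) : B.bracket f g z = - B.bracket g f z :=
  B.skew z _ _

theorem bracket_const_left (c : ℝ) (g : P → ℝ) (z : P) : B.bracket (fun _ => c) g z = 0 := by
  rw [bracket_apply, dAt_const]
  rfl

theorem bracket_add_left {f f' : P → ℝ} (g : P → ℝ) {z : P}
    (hf : MDifferentiableAt I 𝓘(ℝ, ℝ) f z) (hf' : MDifferentiableAt I 𝓘(ℝ, ℝ) f' z) :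
    B.bracket (fun y => f y + f' y) g z = B.bracket f g z + B.bracket f' g z := by
  simp only [bracket_apply, dAt_add hf hf']
  rfl

theorem bracket_sub_left {f f' : P → ℝ} (g : P → ℝ) {z : P}
    (hf : MDifferentiableAt I 𝓘(ℝ, ℝ) f z) (hf' : MDifferentiableAt I 𝓘(ℝ, ℝ) f' z) :
    B.bracket (fun y => f y - f' y) g z = B.bracket f g z - B.bracket f' g z := by
  simp only [bracket_apply, dAt_sub hf hf']
  rfl

theorem bracket_mul_left {f f' : P → ℝ} (g : P → ℝ) {z : P}
    (hf : MDifferentiableAt I 𝓘(ℝ, ℝ) f z) (hf' : MDifferentiableAt I 𝓘(ℝ, ℝ) f' z) :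
    B.bracket (fun y => f y * f' y) g z = f z * B.bracket f' g z + f' z * B.bracket f g z := by
  simp only [bracket_apply, dAt_mul hf hf']
  rfl

theorem bracket_const_mul_left {f : P → ℝ} (c : ℝ) (g : P → ℝ) {z : P}
    (hf : MDifferentiableAt I 𝓘(ℝ, ℝ) f z) :
    B.bracket (fun y => c * f y) g z = c * B.bracket f g z := by
  simp only [bracket_apply, dAt_const_mul c hf]
  rfl

theorem contMDiffOn_bracket {U : Set P} (hU : IsOpen U) {f g : P → ℝ}
    (hf : ContMDiffOn I 𝓘(ℝ, ℝ) ∞ f U) (hg : ContMDiffOn I 𝓘(ℝ, ℝ) ∞ g U) :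
    ContMDiffOn I 𝓘(ℝ, ℝ) ∞ (B.bracket f g) U :=
  B.smooth U hU f g hf hg

end PoissonStructure

/-! ### Invariant functions and invariant open sets -/

variable {G : Type*}

namespace IsInvariantSmoothOn

variable {Φ : G → P → P} {U U' : Set P} {f g : P → ℝ}

theorem mdifferentiableAt (hf : IsInvariantSmoothOn I Φ U f) {z : P} (hz : z ∈ U) :
    MDifferentiableAt I 𝓘(ℝ, ℝ) f z :=
  mdifferentiableAt_of_isOpen hf.isOpen hf.smooth hz

theorem mono (hf : IsInvariantSmoothOn I Φ U f) (h : U' ⊆ U) (ho : IsOpen U')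
    (hi : IsGInvariantSet Φ U') : IsInvariantSmoothOn I Φ U' f :=
  ⟨ho, hi, hf.smooth.mono h, fun γ z hz => hf.comp_eq γ z (h hz)⟩

theorem const (ho : IsOpen U) (hi : IsGInvariantSet Φ U) (c : ℝ) :
    IsInvariantSmoothOn I Φ U (fun _ => c) :=
  ⟨ho, hi, contMDiffOn_const, fun _ _ _ => rfl⟩

theorem add (hf : IsInvariantSmoothOn I Φ U f) (hg : IsInvariantSmoothOn I Φ U g) :
    IsInvariantSmoothOn I Φ U (fun z => f z + g z) :=
  ⟨hf.isOpen, hf.invariant, hf.smooth.add hg.smooth, fun γ z hz => by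
    simp only [hf.comp_eq γ z hz, hg.comp_eq γ z hz]⟩

theorem sub (hf : IsInvariantSmoothOn I Φ U f) (hg : IsInvariantSmoothOn I Φ U g) :
    IsInvariantSmoothOn I Φ U (fun z => f z - g z) :=
  ⟨hf.isOpen, hf.invariant, hf.smooth.sub hg.smooth, fun γ z hz => by
    simp only [hf.comp_eq γ z hz, hg.comp_eq γ z hz]⟩

theorem mul (hf : IsInvariantSmoothOn I Φ U f) (hg : IsInvariantSmoothOn I Φ U g) :
    IsInvariantSmoothOn I Φ U (fun z => f z * g z) :=
  ⟨hf.isOpen, hf.invariant, hf.smooth.mul hg.smooth, fun γ z hz => by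
    simp only [hf.comp_eq γ z hz, hg.comp_eq γ z hz]⟩

/-- The bracket of invariant functions is invariant. -/
theorem bracket {B : PoissonStructure I P} (hΦ : ∀ γ, B.IsPoissonMap (Φ γ))
    (hf : IsInvariantSmoothOn I Φ U f) (hg : IsInvariantSmoothOn I Φ U g) :
    IsInvariantSmoothOn I Φ U (B.bracket f g) := by
  refine ⟨hf.isOpen, hf.invariant, B.contMDiffOn_bracket hf.isOpen hf.smooth hg.smooth,
    fun γ z hz => ?_⟩
  have hφ : MDifferentiableAt I I (Φ γ) z := ((hΦ γ).1 z).mdifferentiableAt (by simp)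
  -- Differentiating `h ∘ Φ γ = h` shows that pulling back `dh` at `Φ γ z` gives `dh` at `z`.
  have key : ∀ {h : P → ℝ}, IsInvariantSmoothOn I Φ U h →
      (dAt I h (Φ γ z)).comp (mfderiv I I (Φ γ) z) = dAt I h z := fun {h} hh => by
    rw [← dAt_comp (hh.mdifferentiableAt (hh.invariant γ z hz)) hφ]
    exact dAt_congr_of_isOpen hh.isOpen (fun y hy => hh.comp_eq γ y hy) hz
  have h := (hΦ γ).2 z (dAt I f (Φ γ z)) (dAt I g (Φ γ z))
  rw [key hf, key hg] at h
  exact h.symm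

end IsInvariantSmoothOn

omit [TopologicalSpace P] in
theorem IsGInvariantSet.inter {Φ : G → P → P} {A A' : Set P} (h : IsGInvariantSet Φ A)
    (h' : IsGInvariantSet Φ A') : IsGInvariantSet Φ (A ∩ A') :=
  fun g z hz => ⟨h g z hz.1, h' g z hz.2⟩

/-- An open subset of an embedded invariant submanifold that is invariant is cut out by an open
invariant set. -/
theorem exists_invariant_isOpen_preimage [Group G] {Φ : G → P → P} (hone : ∀ z, Φ 1 z = z)
    (hmul : ∀ g h z, Φ (g * h) z = Φ g (Φ h z)) (hcont : ∀ g, Continuous (Φ g))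
    {ι : W → P} (hι : Topology.IsInducing ι) (hinj : Function.Injective ι)
    (hW : IsGInvariantSet Φ (range ι)) {A : Set W} (hA : IsOpen A)
    (hAinv : IsGInvariantSet Φ (ι '' A)) :
    ∃ O : Set P, IsOpen O ∧ IsGInvariantSet Φ O ∧ ι ⁻¹' O = A := by
  obtain ⟨O, hO, rfl⟩ := hι.isOpen_iff.1 hA
  -- An ambient open `O` with trace `A` need not be invariant; its saturation is, and invariance of
  -- `A` keeps the trace unchanged.
  refine ⟨⋃ g, Φ g ⁻¹' O, isOpen_iUnion fun g => hO.preimage (hcont g), ?_, ?_⟩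
  · intro h z hz
    obtain ⟨g, hg⟩ := mem_iUnion.1 hz
    refine mem_iUnion.2 ⟨g * h⁻¹, ?_⟩
    rw [mem_preimage, ← hmul, inv_mul_cancel_right]
    exact hg
  · ext n
    constructor
    · intro hn
      obtain ⟨g, hg⟩ := mem_iUnion.1 hn
      -- The translate of `n` that enters `O` stays in the submanifold, hence lies in `A`;
      -- translating back by `g⁻¹` stays in `A`.
      obtain ⟨m, hm⟩ := hW g (ι n) ⟨n, rfl⟩
      have hm' : m ∈ ι ⁻¹' O := by
        rw [mem_preimage, hm]
        exact hg
      obtain ⟨n', hn', he⟩ := hAinv g⁻¹ (ι m) ⟨m, hm', rfl⟩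
      rw [hm, ← hmul, inv_mul_cancel, hone] at he
      exact hinj he ▸ hn'
    · intro hn
      refine mem_iUnion.2 ⟨1, ?_⟩
      rw [mem_preimage, hone]
      exact hn

end General

section General

variable {EP : Type*} [NormedAddCommGroup EP] [NormedSpace ℝ EP]
  {HP : Type*} [TopologicalSpace HP] {I : ModelWithCorners ℝ EP HP}
  {P : Type*} [TopologicalSpace P] [ChartedSpace HP P]
  {EW : Type*} [NormedAddCommGroup EW] [NormedSpace ℝ EW]
  {W : Type*} [TopologicalSpace W] [ChartedSpace EW W]

/-! ### Flows of sections and leaves -/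

variable [IsManifold 𝓘(ℝ, EW) ∞ W]

variable {D : ∀ n : W, Submodule ℝ (TangentSpace 𝓘(ℝ, EW) n)}

theorem IsFlowInvariant.inter {A A' : Set W} (h : IsFlowInvariant D A)
    (h' : IsFlowInvariant D A') : IsFlowInvariant D (A ∩ A') :=
  fun a b hab ha => ⟨h a b hab ha.1, h' a b hab ha.2⟩

theorem FlowStep.leafProj_eq {a b : W} (h : FlowStep D a b) : leafProj D a = leafProj D b :=
  Quot.sound h

theorem isFlowInvariant_preimage (V : Set (LeafSpace D)) :
    IsFlowInvariant D (leafProj D ⁻¹' V) := fun a b hab ha => by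
  rw [mem_preimage, ← hab.leafProj_eq]
  exact ha

theorem isOpen_preimage_leafProj {V : Set (LeafSpace D)} (hV : IsOpen V) :
    IsOpen (leafProj D ⁻¹' V) :=
  isOpen_coinduced.1 hV

/-- A function that is unchanged by flow steps starting in an invariant set is constant on the
leaves in that set. -/
theorem IsFlowInvariant.eq_of_leafProj_eq {α : Type*} {A : Set W} (hA : IsFlowInvariant D A)
    (F : W → α) (hF : ∀ a b, FlowStep D a b → a ∈ A → F a = F b) {a b : W}
    (h : leafProj D a = leafProj D b) (ha : a ∈ A) : F a = F b := by
  -- Membership is carried through the induction with the equality, since each step of a chain may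
  -- be used only from a point known to lie in `A`.
  have key : ∀ a b, Relation.EqvGen (FlowStep D) a b →
      (a ∈ A ↔ b ∈ A) ∧ (a ∈ A → F a = F b) := by
    intro a b hab
    induction hab with
    | rel a b hab => exact ⟨⟨hA a b hab, hA b a hab.symm⟩, hF a b hab⟩
    | refl a => exact ⟨Iff.rfl, fun _ => rfl⟩
    | symm a b _ ih => exact ⟨ih.1.symm, fun hb => (ih.2 (ih.1.2 hb)).symm⟩
    | trans a b c _ _ ih1 ih2 =>
      exact ⟨ih1.1.trans ih2.1, fun ha => (ih1.2 ha).trans (ih2.2 (ih1.1.1 ha))⟩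
  exact (key a b (Quot.eqvGen_exact h)).2 ha

/-- Along a flow step inside an invariant set, the intermediate points stay in the set. -/
theorem IsFlowInvariant.mapsTo_uIcc {A : Set W} (hA : IsFlowInvariant D A) {O : Set W}
    {X : ∀ n : W, TangentSpace 𝓘(ℝ, EW) n} {γ : ℝ → W} {s t : ℝ} (hX : IsLocalSection D O X)
    (hO : ∀ r ∈ uIcc s t, γ r ∈ O) (hγ : IsMIntegralCurveOn (I := 𝓘(ℝ, EW)) γ X (uIcc s t))
    (hs : γ s ∈ A) {r : ℝ} (hr : r ∈ uIcc s t) : γ r ∈ A := by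
  have hsub : uIcc s r ⊆ uIcc s t := uIcc_subset_uIcc left_mem_uIcc hr
  exact hA (γ s) (γ r) ⟨O, X, γ, s, r, hX, fun q hq => hO q (hsub hq), hγ.mono hsub, rfl, rfl⟩ hs

/-- Mean value inequality with constant `0`. Derivatives within the set are what integral curves on
closed intervals provide. -/
theorem eq_of_hasFDerivWithinAt_zero {V V' : Type*} [NormedAddCommGroup V] [NormedSpace ℝ V]
    [NormedAddCommGroup V'] [NormedSpace ℝ V'] {s : Set V} (hs : Convex ℝ s) {f : V → V'}
    (hf : ∀ x ∈ s, HasFDerivWithinAt f (0 : V →L[ℝ] V') s x) {x y : V} (hx : x ∈ s)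
    (hy : y ∈ s) : f x = f y := by
  have h := hs.norm_image_sub_le_of_norm_hasFDerivWithin_le (C := 0) hf (fun _ _ => by simp) hy hx
  rwa [zero_mul, norm_le_zero_iff, sub_eq_zero] at h

/-- A function whose differential kills the sections of `D` is unchanged by flow steps. -/
theorem IsFlowInvariant.eq_of_flowStep {A : Set W} (hA : IsFlowInvariant D A) {F : W → ℝ}
    (hF : ∀ n ∈ A, MDifferentiableAt 𝓘(ℝ, EW) 𝓘(ℝ, ℝ) F n)
    (hk : ∀ n ∈ A, ∀ v ∈ D n, dAt 𝓘(ℝ, EW) F n v = 0) {a b : W} (h : FlowStep D a b)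
    (ha : a ∈ A) : F a = F b := by
  obtain ⟨O, X, γ, s, t, hX, hO, hγ, rfl, rfl⟩ := h
  have hmem : ∀ r ∈ uIcc s t, γ r ∈ A := fun r hr => hA.mapsTo_uIcc hX hO hγ ha hr
  refine eq_of_hasFDerivWithinAt_zero (f := F ∘ γ) (convex_uIcc s t) (fun r hr => ?_)
    left_mem_uIcc right_mem_uIcc
  have h1 := (hF _ (hmem r hr)).hasMFDerivAt.comp_hasMFDerivWithinAt r (hγ r hr)
  have h3 := hk _ (hmem r hr) (X (γ r)) (hX.2.2 _ (hO r hr))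
  have h4 : (mfderiv 𝓘(ℝ, EW) 𝓘(ℝ, ℝ) F (γ r)).comp
      ((1 : ℝ →L[ℝ] ℝ).smulRight (X (γ r))) = 0 := by
    refine ContinuousLinearMap.ext fun c => ?_
    change dAt 𝓘(ℝ, EW) F (γ r) (c • X (γ r)) = 0
    rw [map_smul, h3, smul_zero]
  exact h1.hasFDerivWithinAt.congr_fderiv h4

omit [IsManifold 𝓘(ℝ, EW) ∞ W] in
/-- The set where a regular distribution vanishes is clopen. -/
theorem IsRegularDistribution.isClopen_eq_bot [FiniteDimensional ℝ EW]
    (hD : IsRegularDistribution D) : IsClopen {n | D n = ⊥} := by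
  have hfin : ∀ n : W, FiniteDimensional ℝ (TangentSpace 𝓘(ℝ, EW) n) :=
    fun n => (inferInstance : FiniteDimensional ℝ EW)
  -- `finrank` also defaults to `0` in infinite dimension; finite dimension of `EW` is what makes
  -- rank zero mean trivial.
  have key : ∀ n : W, D n = ⊥ ↔ Module.finrank ℝ (D n) = 0 := fun n =>
    Submodule.finrank_eq_zero.symm
  constructor
  · rw [← isOpen_compl_iff, isOpen_iff_mem_nhds]
    intro n hn
    filter_upwards [hD n] with m hm
    exact fun h => hn ((key n).2 (hm.symm.trans ((key m).1 h)))
  · rw [isOpen_iff_mem_nhds]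
    intro n hn
    filter_upwards [hD n] with m hm
    exact (key m).2 (hm.trans ((key n).1 hn))

omit [IsManifold 𝓘(ℝ, EW) ∞ W] in
/-- A curve in a manifold with zero velocity on an interval is constant. -/
theorem eq_of_hasMFDerivWithinAt_zero [IsManifold 𝓘(ℝ, EW) 1 W] {γ : ℝ → W} {s t : ℝ}
    (h : ∀ r ∈ uIcc s t, HasMFDerivWithinAt 𝓘(ℝ, ℝ) 𝓘(ℝ, EW) γ (uIcc s t) r 0) :
    γ s = γ t := by
  have hloc : IsLocallyConstant ((uIcc s t).domRestrict γ) := by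
    rw [IsLocallyConstant.iff_eventually_eq]
    rintro ⟨r, hr⟩
    have hcont : ContinuousOn γ (uIcc s t) := fun q hq => (h q hq).continuousWithinAt
    have hsrc : ∀ᶠ q in 𝓝[uIcc s t] r, γ q ∈ (chartAt EW (γ r)).source :=
      hcont r hr ((chartAt EW (γ r)).open_source.mem_nhds (mem_chart_source _ _))
    obtain ⟨ε, hε, hball⟩ := Metric.mem_nhdsWithin_iff.1 hsrc
    -- In one chart the curve has zero derivative on a convex set, so its chart image is constant
    -- there; injectivity of the chart transfers this to `γ`.
    have hconv : Convex ℝ (Metric.ball r ε ∩ uIcc s t) :=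
      (convex_ball r ε).inter (convex_uIcc s t)
    have hder : ∀ q ∈ Metric.ball r ε ∩ uIcc s t, HasFDerivWithinAt
        (extChartAt 𝓘(ℝ, EW) (γ r) ∘ γ) (0 : ℝ →L[ℝ] EW) (Metric.ball r ε ∩ uIcc s t) q := by
      intro q hq
      have h1 := (mdifferentiableAt_extChartAt (I := 𝓘(ℝ, EW))
        (hball hq)).hasMFDerivAt.comp_hasMFDerivWithinAt q
        ((h q hq.2).mono (inter_subset_right (s := Metric.ball r ε)))
      exact h1.hasFDerivWithinAt.congr_fderiv (ContinuousLinearMap.comp_zero _)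
    have hmem : Metric.ball r ε ∩ uIcc s t ∈ 𝓝[uIcc s t] r :=
      Filter.inter_mem (mem_nhdsWithin_of_mem_nhds (Metric.ball_mem_nhds r hε))
        self_mem_nhdsWithin
    have hev : ∀ᶠ q in 𝓝[uIcc s t] r, γ q = γ r := by
      filter_upwards [hmem] with q hq
      have hr' : r ∈ Metric.ball r ε ∩ uIcc s t := ⟨Metric.mem_ball_self hε, hr⟩
      have heq : (extChartAt 𝓘(ℝ, EW) (γ r) ∘ γ) q = (extChartAt 𝓘(ℝ, EW) (γ r) ∘ γ) r :=
        eq_of_hasFDerivWithinAt_zero hconv hder hq hr'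
      refine (extChartAt 𝓘(ℝ, EW) (γ r)).injOn ?_ ?_ heq
      · rw [extChartAt_source]
        exact hball hq
      · exact mem_extChartAt_source _
    rw [nhds_subtype_eq_comap]
    rw [nhdsWithin_eq_map_subtype_coe hr] at hev
    rw [← nhds_subtype_eq_comap]
    exact hev
  have : PreconnectedSpace (uIcc s t) :=
    isPreconnected_iff_preconnectedSpace.1 isPreconnected_uIcc
  exact hloc.apply_eq_of_preconnectedSpace ⟨s, left_mem_uIcc⟩ ⟨t, right_mem_uIcc⟩

/-- Where a regular distribution vanishes, its leaves are points. -/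
theorem IsRegularDistribution.eq_of_leafProj_eq [FiniteDimensional ℝ EW]
    (hD : IsRegularDistribution D) {a b : W} (h : leafProj D a = leafProj D b)
    (ha : D a = ⊥) : a = b := by
  have hstep : ∀ a b, FlowStep D a b → a ∈ {n | D n = ⊥} → a = b := by
    rintro a b ⟨O, X, γ, s, t, hX, hO, hγ, rfl, rfl⟩ ha
    have hcont : ContinuousOn γ (uIcc s t) := fun q hq => (hγ q hq).continuousWithinAt
    -- The image of the curve is connected and meets a clopen set, so it stays where `D` vanishes
    -- and its velocity is zero.
    have himg : γ '' uIcc s t ⊆ {n | D n = ⊥} :=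
      (isPreconnected_uIcc.image γ hcont).subset_isClopen hD.isClopen_eq_bot
        ⟨γ s, mem_image_of_mem γ left_mem_uIcc, ha⟩
    have hone : IsManifold 𝓘(ℝ, EW) 1 W := IsManifold.of_le (n := ∞) (by simp)
    refine eq_of_hasMFDerivWithinAt_zero (EW := EW) fun r hr => ?_
    have hz : X (γ r) = 0 := by
      have h1 := hX.2.2 _ (hO r hr)
      rw [show D (γ r) = ⊥ from himg (mem_image_of_mem γ hr)] at h1
      exact h1
    have h2 := hγ r hr
    rw [hz, ContinuousLinearMap.smulRight_zero] at h2
    exact h2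
  have hA : IsFlowInvariant D {n | D n = ⊥} := fun a b hab ha => hstep a b hab ha ▸ ha
  exact hA.eq_of_leafProj_eq (fun n => n) hstep h ha

end General

section General

variable {EP : Type*} [NormedAddCommGroup EP] [NormedSpace ℝ EP]
  {HP : Type*} [TopologicalSpace HP] {I : ModelWithCorners ℝ EP HP}
  {P : Type*} [TopologicalSpace P] [ChartedSpace HP P]
  {EW : Type*} [NormedAddCommGroup EW] [NormedSpace ℝ EW]
  {W : Type*} [TopologicalSpace W] [ChartedSpace EW W]

/-! ### Local extensions and their brackets -/

variable {G : Type*} {Φ : G → P → P} {ι : W → P}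
  {D : ∀ z : P, Submodule ℝ (TangentSpace I z)}

section Kills

variable {F F' : P → ℝ} {A A' : Set W} {U U' : Set P}

omit [TopologicalSpace W] in
theorem KillsOn.mono (h : KillsOn ι D F A U) (hA : ∀ n ∈ A', ι n ∈ U' → n ∈ A)
    (hU : U' ⊆ U) : KillsOn ι D F A' U' :=
  fun n hn hnU => h n (hA n hn hnU) (hU hnU)

omit [TopologicalSpace W] in
theorem KillsOn.sub (h : KillsOn ι D F A U) (h' : KillsOn ι D F' A U)
    (hF : ∀ z ∈ U, MDifferentiableAt I 𝓘(ℝ, ℝ) F z)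
    (hF' : ∀ z ∈ U, MDifferentiableAt I 𝓘(ℝ, ℝ) F' z) :
    KillsOn ι D (fun z => F z - F' z) A U := fun n hn hU v hv => by
  rw [dAt_sub (hF _ hU) (hF' _ hU), sub_apply, h n hn hU v hv,
    h' n hn hU v hv, sub_zero]

omit [TopologicalSpace W] in
theorem KillsOn.add (h : KillsOn ι D F A U) (h' : KillsOn ι D F' A U)
    (hF : ∀ z ∈ U, MDifferentiableAt I 𝓘(ℝ, ℝ) F z)
    (hF' : ∀ z ∈ U, MDifferentiableAt I 𝓘(ℝ, ℝ) F' z) :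
    KillsOn ι D (fun z => F z + F' z) A U := fun n hn hU v hv => by
  rw [dAt_add (hF _ hU) (hF' _ hU), add_apply, h n hn hU v hv,
    h' n hn hU v hv, add_zero]

omit [TopologicalSpace W] in
theorem KillsOn.mul (h : KillsOn ι D F A U) (h' : KillsOn ι D F' A U)
    (hF : ∀ z ∈ U, MDifferentiableAt I 𝓘(ℝ, ℝ) F z)
    (hF' : ∀ z ∈ U, MDifferentiableAt I 𝓘(ℝ, ℝ) F' z) :
    KillsOn ι D (fun z => F z * F' z) A U := fun n hn hU v hv => by
  rw [dAt_mul (hF _ hU) (hF' _ hU), add_apply,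
    smul_apply, smul_apply, h n hn hU v hv,
    h' n hn hU v hv, smul_zero, smul_zero, add_zero]

omit [TopologicalSpace W] in
theorem KillsOn.const (c : ℝ) : KillsOn ι D (fun _ => c) A U := fun n _ _ v _ => by
  rw [dAt_const]
  rfl

variable [IsManifold 𝓘(ℝ, EW) ∞ W]

/-- A function whose differential kills `D` is constant on the leaves of `D_W`. -/
theorem KillsOn.eq_of_leafProj_eq (hι : ContMDiff 𝓘(ℝ, EW) I ∞ ι)
    (h : KillsOn ι D F univ U) (hF : ∀ z ∈ U, MDifferentiableAt I 𝓘(ℝ, ℝ) F z)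
    (hU : IsFlowInvariant (restrictDist (EW := EW) ι D) (ι ⁻¹' U)) {a b : W}
    (hab : leafProj (restrictDist (EW := EW) ι D) a = leafProj (restrictDist ι D) b)
    (ha : ι a ∈ U) : F (ι a) = F (ι b) := by
  have hdiff : ∀ n, MDifferentiableAt 𝓘(ℝ, EW) I ι n := fun n => (hι n).mdifferentiableAt (by simp)
  refine hU.eq_of_leafProj_eq (F ∘ ι) (fun a b hab ha => hU.eq_of_flowStep ?_ ?_ hab ha) hab ha
  · exact fun n hn => (hF _ hn).comp n (hdiff n)
  · intro n hn v hv
    -- A vector lies in `D_W` when `Tι` sends it into `D`, so by the chain rule `d(F ∘ ι)` kills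
    -- `D_W`.
    have hd := ((hF _ hn).hasMFDerivAt.comp n (hdiff n).hasMFDerivAt).mfderiv
    have h1 := h n (mem_univ _) hn (mfderiv 𝓘(ℝ, EW) I ι n v) hv
    rw [dAt, hd]
    exact h1

end Kills

variable [IsManifold 𝓘(ℝ, EW) ∞ W]

section Extensions

variable {V : Set (LeafSpace (restrictDist (EW := EW) ι D))} {f g : V → ℝ} {U U' : Set P}
  {K L : P → ℝ}

theorem IsLocalInvariantExtension.mono (h : IsLocalInvariantExtension Φ ι D V f U K)
    (hU : U' ⊆ U) (ho : IsOpen U') (hi : IsGInvariantSet Φ U')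
    (hfl : IsFlowInvariant (restrictDist (EW := EW) ι D) (ι ⁻¹' U')) :
    IsLocalInvariantExtension Φ ι D V f U' K :=
  ⟨⟨h.1.inv.mono hU ho hi, hfl, fun n hn hnU => h.1.eq n hn (hU hnU)⟩,
    h.2.mono (fun _ hn _ => hn) hU⟩

theorem IsLocalInvariantExtension.inter (h : IsLocalInvariantExtension Φ ι D V f U K)
    (ho : IsOpen U') (hi : IsGInvariantSet Φ U')
    (hfl : IsFlowInvariant (restrictDist (EW := EW) ι D) (ι ⁻¹' U')) :
    IsLocalInvariantExtension Φ ι D V f (U ∩ U') K :=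
  h.mono inter_subset_left (h.1.inv.isOpen.inter ho) (h.1.inv.invariant.inter hi)
    (h.1.flow.inter hfl)

theorem IsLocalInvariantExtension.mdifferentiableAt
    (h : IsLocalInvariantExtension Φ ι D V f U K) {z : P} (hz : z ∈ U) :
    MDifferentiableAt I 𝓘(ℝ, ℝ) K z :=
  h.1.inv.mdifferentiableAt hz

/-- An invariant extension kills `D` only along `π⁻¹(V) ∩ U`, while the Poisson property asks for
all of `U ∩ W`; the two agree once the domain has been shrunk. -/
theorem IsLocalInvariantExtension.killsOn_univ (h : IsLocalInvariantExtension Φ ι D V f U K)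
    (hV : ι ⁻¹' U ⊆ leafProj (restrictDist ι D) ⁻¹' V) : KillsOn ι D K univ U :=
  h.2.mono (fun _ _ hn => hV hn) subset_rfl

theorem IsLocalInvariantExtension.restrict {V' : Set (LeafSpace (restrictDist (EW := EW) ι D))}
    (hV : V' ⊆ V) (h : IsLocalInvariantExtension Φ ι D V f U K) :
    IsLocalInvariantExtension Φ ι D V' (fun x => f ⟨x.1, hV x.2⟩) U K :=
  ⟨⟨h.1.inv, h.1.flow, fun n hn hnU => h.1.eq n (hV hn) hnU⟩,
    h.2.mono (fun _ hn _ => hV hn) subset_rfl⟩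

theorem IsLocalInvariantExtension.add (hf : IsLocalInvariantExtension Φ ι D V f U K)
    (hg : IsLocalInvariantExtension Φ ι D V g U L) :
    IsLocalInvariantExtension Φ ι D V (f + g) U (fun z => K z + L z) :=
  ⟨⟨hf.1.inv.add hg.1.inv, hf.1.flow, fun n hn hnU => by
    simp only [hf.1.eq n hn hnU, hg.1.eq n hn hnU, Pi.add_apply]⟩,
    hf.2.add hg.2 (fun _ => hf.mdifferentiableAt) fun _ => hg.mdifferentiableAt⟩

theorem IsLocalInvariantExtension.mul (hf : IsLocalInvariantExtension Φ ι D V f U K)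
    (hg : IsLocalInvariantExtension Φ ι D V g U L) :
    IsLocalInvariantExtension Φ ι D V (f * g) U (fun z => K z * L z) :=
  ⟨⟨hf.1.inv.mul hg.1.inv, hf.1.flow, fun n hn hnU => by
    simp only [hf.1.eq n hn hnU, hg.1.eq n hn hnU, Pi.mul_apply]⟩,
    hf.2.mul hg.2 (fun _ => hf.mdifferentiableAt) fun _ => hg.mdifferentiableAt⟩

theorem IsLocalInvariantExtension.smul (c : ℝ) (hf : IsLocalInvariantExtension Φ ι D V f U K) :
    IsLocalInvariantExtension Φ ι D V (c • f) U (fun z => c * K z) :=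
  ⟨⟨(IsInvariantSmoothOn.const hf.1.inv.isOpen hf.1.inv.invariant c).mul hf.1.inv, hf.1.flow,
    fun n hn hnU => by simp only [hf.1.eq n hn hnU, Pi.smul_apply, smul_eq_mul]⟩,
    (KillsOn.const c).mul hf.2 (fun _ _ => mdifferentiableAt_const)
      fun _ => hf.mdifferentiableAt⟩

end Extensions

/-! ### Reduction data and invariant extensions -/

variable (B : PoissonStructure I P)

/-- The data of a Poisson symmetry `Φ` of `P`, an embedded `Φ`-invariant submanifold `ι` and a
Poisson distribution along it for which local extensions can be chosen invariant. -/
structure ReductionData [Group G] (Φ : G → P → P) (ι : W → P)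
    (D : ∀ z : P, Submodule ℝ (TangentSpace I z)) : Prop where
  one : ∀ z, Φ 1 z = z
  mul : ∀ g h z, Φ (g * h) z = Φ g (Φ h z)
  poisson : ∀ g, B.IsPoissonMap (Φ g)
  embedding : Manifold.IsSmoothEmbedding 𝓘(ℝ, EW) I ∞ ι
  invariant : IsGInvariantSet Φ (range ι)
  canonical : IsPoissonDistribution B ι D
  extension : HasLocalExtensionProperty (EW := EW) Φ ι D

namespace ReductionData

variable {B} [Group G] (R : ReductionData (EW := EW) B Φ ι D)
include R

theorem exists_isOpen {A : Set W} (hA : IsOpen A) (hAinv : IsGInvariantSet Φ (ι '' A)) :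
    ∃ O : Set P, IsOpen O ∧ IsGInvariantSet Φ O ∧ ι ⁻¹' O = A :=
  exists_invariant_isOpen_preimage R.one R.mul (fun g => (R.poisson g).1.continuous)
    R.embedding.isEmbedding.isInducing R.embedding.isEmbedding.injective R.invariant hA hAinv

/-- Intersecting an extension's domain with such an `O` cuts `U ∩ W` down to `π⁻¹(V)` and keeps the
domain open, invariant and saturated by leaves. -/
theorem exists_isOpen_leaf (V : InvOpens (EW := EW) Φ ι D) :
    ∃ O : Set P, IsOpen O ∧ IsGInvariantSet Φ O ∧
      ι ⁻¹' O = leafProj (restrictDist ι D) ⁻¹' V.1 :=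
  R.exists_isOpen (isOpen_preimage_leafProj V.2.1) V.2.2

/-- Invariant extensions exist at every point of `π⁻¹(V)`, on a domain that meets the submanifold
inside `π⁻¹(V)`. -/
theorem exists_extension (V : InvOpens (EW := EW) Φ ι D) (f : leafFunctions Φ ι D V.1) {n : W}
    (hn : leafProj (restrictDist ι D) n ∈ V.1) :
    ∃ U K, ι n ∈ U ∧ ι ⁻¹' U ⊆ leafProj (restrictDist ι D) ⁻¹' V.1 ∧
      IsLocalInvariantExtension Φ ι D V.1 f.1 U K := by
  -- The extension property supplies an extension at some point `m` of the leaf only; flow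
  -- invariance of `U ∩ W` puts `n` in the same domain.
  obtain ⟨m, hm, U, K, hmU, hK⟩ := R.extension V f _ hn
  obtain ⟨O, hO, hOinv, hOV⟩ := R.exists_isOpen_leaf V
  have hnO : n ∈ ι ⁻¹' O := hOV ▸ hn
  refine ⟨U ∩ O, K, ⟨hK.1.flow.mem_of_leafProj_eq hm hmU, hnO⟩, ?_, hK.inter hO hOinv ?_⟩
  · rw [← hOV]
    exact fun p hp => hp.2
  · rw [hOV]
    exact isFlowInvariant_preimage _

theorem exists_extension₂ (V : InvOpens (EW := EW) Φ ι D) (f g : leafFunctions Φ ι D V.1) {n : W}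
    (hn : leafProj (restrictDist ι D) n ∈ V.1) :
    ∃ U K L, ι n ∈ U ∧ ι ⁻¹' U ⊆ leafProj (restrictDist ι D) ⁻¹' V.1 ∧
      IsLocalInvariantExtension Φ ι D V.1 f.1 U K ∧
      IsLocalInvariantExtension Φ ι D V.1 g.1 U L := by
  obtain ⟨U, K, hU, hUV, hK⟩ := R.exists_extension V f hn
  obtain ⟨U', L, hU', -, hL⟩ := R.exists_extension V g hn
  refine ⟨U ∩ U', K, L, ⟨hU, hU'⟩, fun p hp => hUV hp.1,
    hK.inter hL.1.inv.isOpen hL.1.inv.invariant hL.1.flow, ?_⟩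
  rw [inter_comm]
  exact hL.inter hK.1.inv.isOpen hK.1.inv.invariant hK.1.flow

theorem exists_extension₃ (V : InvOpens (EW := EW) Φ ι D) (f g h : leafFunctions Φ ι D V.1)
    {n : W} (hn : leafProj (restrictDist ι D) n ∈ V.1) :
    ∃ U K L M, ι n ∈ U ∧ ι ⁻¹' U ⊆ leafProj (restrictDist ι D) ⁻¹' V.1 ∧
      IsLocalInvariantExtension Φ ι D V.1 f.1 U K ∧
      IsLocalInvariantExtension Φ ι D V.1 g.1 U L ∧
      IsLocalInvariantExtension Φ ι D V.1 h.1 U M := by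
  obtain ⟨U, K, L, hU, hUV, hK, hL⟩ := R.exists_extension₂ V f g hn
  obtain ⟨U', M, hU', -, hM⟩ := R.exists_extension V h hn
  refine ⟨U ∩ U', K, L, M, ⟨hU, hU'⟩, fun p hp => hUV hp.1,
    hK.inter hM.1.inv.isOpen hM.1.inv.invariant hM.1.flow,
    hL.inter hM.1.inv.isOpen hM.1.inv.invariant hM.1.flow, ?_⟩
  rw [inter_comm]
  exact hM.inter hK.1.inv.isOpen hK.1.inv.invariant hK.1.flow

/-- The bracket of invariant extensions is constant on leaves. -/
theorem bracket_eq_of_leafProj_eq {V : InvOpens (EW := EW) Φ ι D} {f g : V.1 → ℝ} {U : Set P}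
    {K L : P → ℝ} (hK : IsLocalInvariantExtension Φ ι D V.1 f U K)
    (hL : IsLocalInvariantExtension Φ ι D V.1 g U L)
    (hUV : ι ⁻¹' U ⊆ leafProj (restrictDist ι D) ⁻¹' V.1) {a b : W}
    (hab : leafProj (restrictDist (EW := EW) ι D) a = leafProj (restrictDist ι D) b)
    (ha : ι a ∈ U) : B.bracket K L (ι a) = B.bracket K L (ι b) :=
  KillsOn.eq_of_leafProj_eq R.embedding.contMDiff
    (R.canonical U K L hK.1.inv.isOpen hK.1.inv.smooth hL.1.inv.smooth
      (hK.killsOn_univ hUV) (hL.killsOn_univ hUV))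
    (fun _ => (hK.1.inv.bracket R.poisson hL.1.inv).mdifferentiableAt) hK.1.flow hab ha

end ReductionData

omit [TopologicalSpace W] in
variable {B} in
/-- Functions in `Δ^G` commute at `z` with those in `(Δ^G)_W`. -/
theorem bracket_eq_zero_of_annihilator
    {n : W} (hn : B.sharp (ι n) '' invCodist Φ ι D (ι n)
      ⊆ annihilatorOf (invCodistConst Φ ι D (ι n)))
    {U : Set P} {f g : P → ℝ} (hU : ι n ∈ U) (hf : IsInvariantSmoothOn I Φ U f)
    (hfk : KillsOn ι D f univ U) (hg : IsInvariantSmoothOn I Φ U g)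
    (hgk : KillsOn ι D g univ U) (hc : ∃ c, ∀ m : W, ι m ∈ U → g (ι m) = c) :
    B.bracket g f (ι n) = 0 :=
  hn (mem_image_of_mem _ ⟨U, f, hU, hf, hfk, rfl⟩) _ ⟨U, g, hU, hg, hgk, hc, rfl⟩

/-! ### Sufficiency of the annihilator condition -/

namespace ReductionData

variable {B} [Group G] (R : ReductionData (EW := EW) B Φ ι D)
  (hann : ∀ n : W, B.sharp (ι n) '' invCodist Φ ι D (ι n)
    ⊆ annihilatorOf (invCodistConst Φ ι D (ι n)))
include R hann

/-- After restriction to a domain meeting `W` inside `π⁻¹(V)`, `K - K'` kills `D` and is constantly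
`0` on `W`. Its differential is therefore in `(Δ^G)_W`, which annihilates `B♯ dL`. -/
theorem bracket_eq_of_left {V : InvOpens (EW := EW) Φ ι D} {f g : V.1 → ℝ} {U : Set P}
    {K K' L : P → ℝ} (hK : IsLocalInvariantExtension Φ ι D V.1 f U K)
    (hK' : IsLocalInvariantExtension Φ ι D V.1 f U K')
    (hL : IsLocalInvariantExtension Φ ι D V.1 g U L)
    {n : W} (hn : leafProj (restrictDist ι D) n ∈ V.1) (hnU : ι n ∈ U) :
    B.bracket K L (ι n) = B.bracket K' L (ι n) := by
  obtain ⟨O, hO, hOinv, hOV⟩ := R.exists_isOpen_leaf V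
  have hfl : IsFlowInvariant (restrictDist (EW := EW) ι D) (ι ⁻¹' O) := by
    rw [hOV]
    exact isFlowInvariant_preimage _
  have hUV : ι ⁻¹' (U ∩ O) ⊆ leafProj (restrictDist ι D) ⁻¹' V.1 := by
    rw [← hOV]
    exact fun p hp => hp.2
  have hK1 := hK.inter hO hOinv hfl
  have hK1' := hK'.inter hO hOinv hfl
  have hL1 := hL.inter hO hOinv hfl
  have hnO : n ∈ ι ⁻¹' O := hOV ▸ hn
  have h := bracket_eq_zero_of_annihilator (U := U ∩ O) (hann n) ⟨hnU, hnO⟩ hL1.1.inv (hL1.killsOn_univ hUV)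
    (hK1.1.inv.sub hK1'.1.inv)
    ((hK1.killsOn_univ hUV).sub (hK1'.killsOn_univ hUV) (fun _ => hK1.mdifferentiableAt)
      fun _ => hK1'.mdifferentiableAt)
    ⟨0, fun m hm => by
      rw [hK1.1.eq m (hUV hm) hm, hK1'.1.eq m (hUV hm) hm, sub_self]⟩
  rw [B.bracket_sub_left _ (hK.mdifferentiableAt hnU) (hK'.mdifferentiableAt hnU)] at h
  exact sub_eq_zero.1 h

/-- The bracket of invariant extensions does not depend on the extensions. -/
theorem bracket_eq_of_extensions {V : InvOpens (EW := EW) Φ ι D} {f g : V.1 → ℝ} {U U' : Set P}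
    {K L K' L' : P → ℝ} (hK : IsLocalInvariantExtension Φ ι D V.1 f U K)
    (hL : IsLocalInvariantExtension Φ ι D V.1 g U L)
    (hK' : IsLocalInvariantExtension Φ ι D V.1 f U' K')
    (hL' : IsLocalInvariantExtension Φ ι D V.1 g U' L')
    {n : W} (hn : leafProj (restrictDist ι D) n ∈ V.1) (hnU : ι n ∈ U) (hnU' : ι n ∈ U') :
    B.bracket K L (ι n) = B.bracket K' L' (ι n) := by
  have h1 := hK.inter hK'.1.inv.isOpen hK'.1.inv.invariant hK'.1.flow
  have h2 := hL.inter hK'.1.inv.isOpen hK'.1.inv.invariant hK'.1.flow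
  have h3 := hK'.inter hK.1.inv.isOpen hK.1.inv.invariant hK.1.flow
  have h4 := hL'.inter hK.1.inv.isOpen hK.1.inv.invariant hK.1.flow
  rw [inter_comm] at h3 h4
  -- One argument is exchanged at a time: `{K, L} = {K', L} = -{L, K'} = -{L', K'} = {K', L'}`.
  rw [R.bracket_eq_of_left hann h1 h3 h2 hn ⟨hnU, hnU'⟩, B.bracket_skew,
    R.bracket_eq_of_left hann h2 h4 h3 hn ⟨hnU, hnU'⟩, ← B.bracket_skew]

/-- The reduced bracket of two functions on the leaf space. -/
theorem exists_reduced_bracket (V : InvOpens (EW := EW) Φ ι D) (k l : leafFunctions Φ ι D V.1) :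
    ∃ b : leafFunctions Φ ι D V.1, ∀ (n : W) (hn : leafProj (restrictDist ι D) n ∈ V.1)
      (U : Set P) (K L : P → ℝ), ι n ∈ U → IsLocalInvariantExtension Φ ι D V.1 k.1 U K →
      IsLocalInvariantExtension Φ ι D V.1 l.1 U L → b.1 ⟨_, hn⟩ = B.bracket K L (ι n) := by
  have hrep : ∀ x : V.1, ∃ n, leafProj (restrictDist ι D) n = x.1 := fun x => Quot.exists_rep x.1
  choose r hr using hrep
  have hdata := fun x : V.1 => R.exists_extension₂ V k l (n := r x) ((hr x).symm ▸ x.2)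
  choose U K L hrU hUV hK hL using hdata
  -- The value is computed at a chosen representative of each leaf. It moves to `n` by constancy
  -- along leaves, and at `n` the extensions may be exchanged.
  have hspec : ∀ (n : W) (hn : leafProj (restrictDist ι D) n ∈ V.1) (U' : Set P) (K' L' : P → ℝ),
      ι n ∈ U' → IsLocalInvariantExtension Φ ι D V.1 k.1 U' K' →
      IsLocalInvariantExtension Φ ι D V.1 l.1 U' L' →
      B.bracket (K ⟨_, hn⟩) (L ⟨_, hn⟩) (ι (r ⟨_, hn⟩)) = B.bracket K' L' (ι n) := by
    intro n hn U' K' L' hnU' hK' hL'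
    set x : V.1 := ⟨_, hn⟩
    rw [R.bracket_eq_of_leafProj_eq (hK x) (hL x) (hUV x) (hr x) (hrU x)]
    exact R.bracket_eq_of_extensions hann (hK x) (hL x) hK' hL' hn
      ((hK x).1.flow.mem_of_leafProj_eq (hr x) (hrU x)) hnU'
  refine ⟨⟨fun x => B.bracket (K x) (L x) (ι (r x)), fun x hx => ?_⟩, hspec⟩
  -- The reduced bracket is smooth because `{K, L}`, invariant under the Poisson action, is a local
  -- extension of it.
  refine ⟨r ⟨x, hx⟩, hr ⟨x, hx⟩, U ⟨x, hx⟩, B.bracket (K ⟨x, hx⟩) (L ⟨x, hx⟩), hrU _,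
    (hK _).1.inv.bracket R.poisson (hL _).1.inv, (hK _).1.flow, fun n hn hnU => ?_⟩
  exact (hspec n hn _ _ _ hnU (hK _) (hL _)).symm

/-- The annihilator condition implies Poisson reducibility. -/
theorem isPoissonReducible : IsPoissonReducible (EW := EW) B Φ ι D := by
  choose b hb using R.exists_reduced_bracket hann
  -- Needed for iterated brackets: `{K, L}` kills `D` again, so it may serve as an entry in the
  -- Jacobi identity.
  have hext : ∀ (V : InvOpens (EW := EW) Φ ι D) (k l : leafFunctions Φ ι D V.1) (U : Set P)
      (K L : P → ℝ), ι ⁻¹' U ⊆ leafProj (restrictDist ι D) ⁻¹' V.1 →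
      IsLocalInvariantExtension Φ ι D V.1 k.1 U K →
      IsLocalInvariantExtension Φ ι D V.1 l.1 U L →
      IsLocalInvariantExtension Φ ι D V.1 (b V k l).1 U (B.bracket K L) := by
    intro V k l U K L hUV hK hL
    refine ⟨⟨hK.1.inv.bracket R.poisson hL.1.inv, hK.1.flow, fun n hn hnU =>
      (hb V k l n hn U K L hnU hK hL).symm⟩, ?_⟩
    exact (R.canonical U K L hK.1.inv.isOpen hK.1.inv.smooth hL.1.inv.smooth
      (hK.killsOn_univ hUV) (hL.killsOn_univ hUV)).mono (fun _ _ _ => mem_univ _) subset_rfl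
  have hpt : ∀ {V : InvOpens (EW := EW) Φ ι D} {f g : leafFunctions Φ ι D V.1},
      (∀ n (hn : leafProj (restrictDist ι D) n ∈ V.1), f.1 ⟨_, hn⟩ = g.1 ⟨_, hn⟩) → f = g := by
    intro V f g h
    ext ⟨x, hx⟩
    obtain ⟨n, rfl⟩ := Quot.exists_rep x
    exact h n hx
  have hskew : ∀ V k l, b V k l = - b V l k := by
    intro V k l
    refine hpt fun n hn => ?_
    obtain ⟨U, K, L, hU, -, hK, hL⟩ := R.exists_extension₂ V k l hn
    change (b V k l).1 _ = -((b V l k).1 _)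
    rw [hb V k l n hn U K L hU hK hL, hb V l k n hn U L K hU hL hK, B.bracket_skew]
  have hadd : ∀ V k k' l, b V (k + k') l = b V k l + b V k' l := by
    intro V k k' l
    refine hpt fun n hn => ?_
    obtain ⟨U, K, K', L, hU, -, hK, hK', hL⟩ := R.exists_extension₃ V k k' l hn
    change (b V (k + k') l).1 _ = (b V k l).1 _ + (b V k' l).1 _
    rw [hb V (k + k') l n hn U _ L hU (hK.add hK') hL, hb V k l n hn U K L hU hK hL,
      hb V k' l n hn U K' L hU hK' hL,
      B.bracket_add_left _ (hK.mdifferentiableAt hU) (hK'.mdifferentiableAt hU)]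
  have hsmul : ∀ V (c : ℝ) k l, b V (c • k) l = c • b V k l := by
    intro V c k l
    refine hpt fun n hn => ?_
    obtain ⟨U, K, L, hU, -, hK, hL⟩ := R.exists_extension₂ V k l hn
    change (b V (c • k) l).1 _ = c * (b V k l).1 _
    rw [hb V (c • k) l n hn U _ L hU (hK.smul c) hL, hb V k l n hn U K L hU hK hL,
      B.bracket_const_mul_left _ _ (hK.mdifferentiableAt hU)]
  refine ⟨fun V => LinearMap.mk₂ ℝ (b V) (hadd V) (hsmul V) (fun k l l' => ?_)
    (fun c k l => ?_), hskew, fun V k l m => ?_, fun V k l m => ?_, fun V V' h k l => ?_, hb⟩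
  -- Linearity in the second slot follows from the first by skewness.
  · rw [hskew, hadd, neg_add, ← hskew, ← hskew]
  · rw [hskew, hsmul, ← smul_neg, ← hskew]
  · simp only [LinearMap.mk₂_apply]
    refine hpt fun n hn => ?_
    obtain ⟨U, K, L, M, hU, hUV, hK, hL, hM⟩ := R.exists_extension₃ V k l m hn
    change (b V k (b V l m)).1 _ + (b V l (b V m k)).1 _ + (b V m (b V k l)).1 _ = 0
    rw [hb V k _ n hn U K _ hU hK (hext V l m U L M hUV hL hM),
      hb V l _ n hn U L _ hU hL (hext V m k U M K hUV hM hK),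
      hb V m _ n hn U M _ hU hM (hext V k l U K L hUV hK hL)]
    exact B.jacobi U hK.1.inv.isOpen K L M hK.1.inv.smooth hL.1.inv.smooth hM.1.inv.smooth _ hU
  · simp only [LinearMap.mk₂_apply]
    refine hpt fun n hn => ?_
    obtain ⟨U, K, L, M, hU, -, hK, hL, hM⟩ := R.exists_extension₃ V k l m hn
    change (b V k (l * m)).1 _ = (b V k l).1 _ * m.1 _ + l.1 _ * (b V k m).1 _
    rw [hb V k (l * m) n hn U K _ hU hK (hL.mul hM), hb V k l n hn U K L hU hK hL,
      hb V k m n hn U K M hU hK hM, B.bracket_skew,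
      B.bracket_mul_left _ (hL.mdifferentiableAt hU) (hM.mdifferentiableAt hU),
      ← hL.1.eq n hn hU, ← hM.1.eq n hn hU, B.bracket_skew K L, B.bracket_skew K M]
    ring
  · simp only [LinearMap.mk₂_apply]
    refine hpt fun n hn => ?_
    obtain ⟨U, K, L, hU, -, hK, hL⟩ := R.exists_extension₂ V k l (h hn)
    change (b V k l).1 ⟨_, h hn⟩ = _
    rw [hb V k l n (h hn) U K L hU hK hL]
    exact (hb V' (leafRestrict Φ ι D h k) (leafRestrict Φ ι D h l) n hn U K L hU
      (hK.restrict h) (hL.restrict h)).symm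

end ReductionData

end General

section General

variable {EP : Type*} [NormedAddCommGroup EP] [NormedSpace ℝ EP]
  {HP : Type*} [TopologicalSpace HP] {I : ModelWithCorners ℝ EP HP}
  {P : Type*} [TopologicalSpace P] [ChartedSpace HP P]
  {EW : Type*} [NormedAddCommGroup EW] [NormedSpace ℝ EW]
  {W : Type*} [TopologicalSpace W] [ChartedSpace EW W]

/-! ### Necessity of the annihilator condition -/

variable {G : Type*} {Φ : G → P → P} {ι : W → P} {D : ∀ z : P, Submodule ℝ (TangentSpace I z)}
  {B : PoissonStructure I P}

omit [TopologicalSpace W] in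
/-- Where a Poisson distribution does not vanish, functions that kill it commute with those that
are moreover constant along the submanifold. -/
theorem IsPoissonDistribution.bracket_eq_zero [IsManifold I ∞ P]
    (hD : IsPoissonDistribution B ι D) {n : W} (hn : D (ι n) ≠ ⊥) {U : Set P} {f g : P → ℝ}
    (hU : IsOpen U) (hnU : ι n ∈ U) (hf : ContMDiffOn I 𝓘(ℝ, ℝ) ∞ f U) (hfk : KillsOn ι D f univ U)
    (hg : ContMDiffOn I 𝓘(ℝ, ℝ) ∞ g U) (hgk : KillsOn ι D g univ U) {c : ℝ}
    (hc : ∀ m, ι m ∈ U → g (ι m) = c) : B.bracket g f (ι n) = 0 := by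
  -- The auxiliary `h` need be neither invariant nor compatible with `D`: the Poisson property
  -- concerns all smooth functions on open sets.
  obtain ⟨v, hv, hv0⟩ := Submodule.exists_mem_ne_zero_of_ne_bot hn
  obtain ⟨O, h, hO, hnO, hh, hhv⟩ := exists_dAt_ne_zero (I := I) hv0
  have hUO : IsOpen (U ∩ O) := hU.inter hO
  have hz : ι n ∈ U ∩ O := ⟨hnU, hnO⟩
  have hf' := hf.mono (inter_subset_left (t := O))
  have hh' := hh.mono (inter_subset_right (s := U))
  have hg' : ContMDiffOn I 𝓘(ℝ, ℝ) ∞ (fun z => g z - c) (U ∩ O) :=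
    (hg.mono inter_subset_left).sub contMDiffOn_const
  have hgd : ∀ z ∈ U ∩ O, dAt I (fun z => g z - c) z = dAt I g z := fun z hz => by
    rw [dAt_sub (mdifferentiableAt_of_isOpen hU hg hz.1) mdifferentiableAt_const, dAt_const,
      sub_zero]
  have hhg : ContMDiffOn I 𝓘(ℝ, ℝ) ∞ (fun z => h z * (g z - c)) (U ∩ O) := hh'.mul hg'
  -- Along `W` the factor `g - c` vanishes, so the differential of the product is `h dg` there.
  have hk : KillsOn ι D (fun z => h z * (g z - c)) univ (U ∩ O) := by
    intro m _ hm w hw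
    rw [dAt_mul (mdifferentiableAt_of_isOpen hUO hh' hm) (mdifferentiableAt_of_isOpen hUO hg' hm),
      hc m hm.1, sub_self, zero_smul, add_zero, hgd _ hm, smul_apply,
      hgk m (mem_univ _) hm.1 w hw, smul_zero]
  have hfk' : KillsOn ι D f univ (U ∩ O) := hfk.mono (fun _ hm _ => hm) inter_subset_left
  have hkey := hD (U ∩ O) _ f hUO hhg hf' hk hfk' n (mem_univ _) hz v hv
  have hgf := hD (U ∩ O) g f hUO (hg.mono inter_subset_left) hf'
    (hgk.mono (fun _ hm _ => hm) inter_subset_left) hfk' n (mem_univ _) hz v hv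
  have hexp : EqOn (B.bracket (fun z => h z * (g z - c)) f)
      (fun z => h z * B.bracket g f z + (g z - c) * B.bracket h f z) (U ∩ O) := fun z hz => by
    rw [B.bracket_mul_left _ (mdifferentiableAt_of_isOpen hUO hh' hz)
      (mdifferentiableAt_of_isOpen hUO hg' hz)]
    simp only [PoissonStructure.bracket_apply, hgd z hz]
  have hbgf := B.contMDiffOn_bracket hUO (hg.mono inter_subset_left) hf'
  have hbhf := B.contMDiffOn_bracket hUO hh' hf'
  have d : ∀ {F : P → ℝ}, ContMDiffOn I 𝓘(ℝ, ℝ) ∞ F (U ∩ O) →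
      MDifferentiableAt I 𝓘(ℝ, ℝ) F (ι n) := fun hF => mdifferentiableAt_of_isOpen hUO hF hz
  have hd1 : MDifferentiableAt I 𝓘(ℝ, ℝ) (fun z => h z * B.bracket g f z) (ι n) :=
    d (hh'.mul hbgf)
  have hd2 : MDifferentiableAt I 𝓘(ℝ, ℝ) (fun z => (g z - c) * B.bracket h f z) (ι n) :=
    d (hg'.mul hbhf)
  -- In the derivative along `v`, the terms with `d{g, f}(v)`, `dg(v)` and `g - c` vanish, leaving
  -- `{g, f} dh(v) = 0`.
  rw [dAt_congr_of_isOpen hUO hexp hz, dAt_add hd1 hd2,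
    dAt_mul (d hh') (d hbgf), dAt_mul (d hg') (d hbhf), hgd _ hz, hc n hnU, sub_self] at hkey
  simp only [add_apply, smul_apply, hgf, hgk n (mem_univ _) hnU v hv, zero_smul, zero_add, smul_eq_mul,
    mul_zero, add_zero] at hkey
  exact (mul_eq_zero.1 hkey).resolve_right hhv

/-- The differential of an immersion is injective. -/
theorem mfderiv_injective_of_isImmersionAt [IsManifold 𝓘(ℝ, EW) ∞ W] [IsManifold I ∞ P] {n : W}
    (h : Manifold.IsImmersionAt 𝓘(ℝ, EW) I ∞ ι n) :
    Function.Injective (mfderiv 𝓘(ℝ, EW) I ι n) := by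
  have hchart : h.domChart.MDifferentiable 𝓘(ℝ, EW) 𝓘(ℝ, EW) :=
    ⟨(contMDiffOn_of_mem_maximalAtlas h.domChart_mem_maximalAtlas).mdifferentiableOn (by simp),
      (contMDiffOn_symm_of_mem_maximalAtlas h.domChart_mem_maximalAtlas).mdifferentiableOn
        (by simp)⟩
  -- In adapted charts an immersion is `x ↦ (x, 0)`. Projecting to the first factor recovers the
  -- domain chart, whose injective differential thus factors through `Tι`.
  let p : EP →L[ℝ] EW := (ContinuousLinearMap.fst ℝ EW h.complement).comp
    (h.equiv.symm : EP →L[ℝ] EW × h.complement)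
  have hcod : MDifferentiableAt I 𝓘(ℝ, EP) (h.codChart.extend I) (ι n) :=
    (h.codChart.contMDiffAt_extend h.codChart_mem_maximalAtlas
      h.mem_codChart_source).mdifferentiableAt (by simp)
  have hp : MDifferentiableAt I 𝓘(ℝ, EW) (fun z => p (h.codChart.extend I z)) (ι n) :=
    p.mdifferentiableAt.comp _ hcod
  have heq : (fun m => p (h.codChart.extend I (ι m))) =ᶠ[𝓝 n] h.domChart := by
    filter_upwards [h.domChart.open_source.mem_nhds h.mem_domChart_source] with m hm
    have hm' : h.domChart m ∈ (h.domChart.extend 𝓘(ℝ, EW)).target := by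
      simpa using h.domChart.map_source hm
    have h1 := h.writtenInCharts hm'
    simp only [Function.comp_apply, OpenPartialHomeomorph.extend_coe_symm,
      modelWithCornersSelf_coe_symm, id, h.domChart.left_inv hm] at h1
    change (h.equiv.symm (h.codChart.extend I (ι m))).1 = h.domChart m
    rw [h1, ContinuousLinearEquiv.symm_apply_apply]
  have hd : mfderiv 𝓘(ℝ, EW) 𝓘(ℝ, EW) h.domChart n =
      (mfderiv I 𝓘(ℝ, EW) (fun z => p (h.codChart.extend I z)) (ι n)).comp
        (mfderiv 𝓘(ℝ, EW) I ι n) := by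
    rw [← heq.mfderiv_eq]
    exact mfderiv_comp n hp (h.contMDiffAt.mdifferentiableAt (by simp))
  have hinj := hchart.mfderiv_injective h.mem_domChart_source
  rw [hd] at hinj
  exact Function.Injective.of_comp hinj

/-- A smooth map that preserves an embedded submanifold restricts to a smooth map of the
submanifold. -/
theorem exists_contMDiff_lift [CompleteSpace EP] [CompleteSpace EW]
    (hι : Manifold.IsSmoothEmbedding 𝓘(ℝ, EW) I ∞ ι) {φ : P → P}
    (hφ : ContMDiff I I ∞ φ) (hmaps : ∀ n, φ (ι n) ∈ range ι) :
    ∃ ψ : W → W, ContMDiff 𝓘(ℝ, EW) 𝓘(ℝ, EW) ∞ ψ ∧ ι ∘ ψ = φ ∘ ι := by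
  choose ψ hψ using hmaps
  have hcomp : ι ∘ ψ = φ ∘ ι := funext hψ
  refine ⟨ψ, ?_, hcomp⟩
  -- Smoothness into `W` can be tested after an immersion once continuity is known; continuity comes
  -- from the embedding.
  rw [ContMDiff.iff_comp_isImmersion hι.isImmersion, hcomp]
  refine ⟨?_, hφ.comp hι.contMDiff⟩
  rw [hι.isEmbedding.continuous_iff, hcomp]
  exact hφ.continuous.comp hι.contMDiff.continuous

/-! ### The locus where the induced distribution vanishes -/

variable [IsManifold 𝓘(ℝ, EW) ∞ W]

namespace ReductionData

variable [Group G] (R : ReductionData (EW := EW) B Φ ι D)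
include R

theorem leftInverse (g : G) : Function.LeftInverse (Φ g⁻¹) (Φ g) := fun z => by
  rw [← R.mul, inv_mul_cancel, R.one]

/-- The set where `D_W` vanishes is invariant. -/
theorem isGInvariantSet_eq_bot [CompleteSpace EP] [CompleteSpace EW]
    (hDG : IsGInvariantDistribution Φ ι D) :
    IsGInvariantSet Φ (ι '' {n | restrictDist (EW := EW) ι D n = ⊥}) := by
  rintro g _ ⟨n, hn, rfl⟩
  obtain ⟨ψ, hψs, hψ⟩ := exists_contMDiff_lift R.embedding (R.poisson g).1
    fun k => R.invariant g (ι k) ⟨k, rfl⟩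
  obtain ⟨ψ', hψs', hψ'⟩ := exists_contMDiff_lift R.embedding (R.poisson g⁻¹).1
    fun k => R.invariant g⁻¹ (ι k) ⟨k, rfl⟩
  have hψe : ∀ k, ι (ψ k) = Φ g (ι k) := congrFun hψ
  have hψe' : ∀ k, ι (ψ' k) = Φ g⁻¹ (ι k) := congrFun hψ'
  have hinj := R.embedding.isEmbedding.injective
  have hleft : ∀ k, ψ' (ψ k) = k := fun k => hinj (by rw [hψe', hψe, R.leftInverse])
  have hright : ψ ∘ ψ' = id := funext fun k => hinj (by
    have h := R.leftInverse g⁻¹ (ι k)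
    rw [inv_inv] at h
    change ι (ψ (ψ' k)) = ι k
    rw [hψe, hψe', h])
  refine ⟨ψ n, ?_, hψe n⟩
  -- Writing `n` as `ψ' m` lets every differential be taken at `m`. A vector `v` of `D_W` at `m`
  -- goes to `Tψ' v` in `D_W = 0` at `n`, and `v = Tψ (Tψ' v)`.
  generalize hm : ψ n = m
  obtain rfl : ψ' m = n := by rw [← hm, hleft]
  have dι : ∀ k, MDifferentiableAt 𝓘(ℝ, EW) I ι k := fun k =>
    (R.embedding.contMDiff k).mdifferentiableAt (by simp)
  have dψ := (hψs (ψ' m)).mdifferentiableAt (by simp)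
  have dψ' := (hψs' m).mdifferentiableAt (by simp)
  have h1 := (dι (ψ' m)).hasMFDerivAt.comp m dψ'.hasMFDerivAt
  have h2 := (((R.poisson g⁻¹).1 (ι m)).mdifferentiableAt (by simp)).hasMFDerivAt.comp m
    (dι m).hasMFDerivAt
  have h3 := dψ.hasMFDerivAt.comp m dψ'.hasMFDerivAt
  rw [hright] at h3
  rw [hψ'] at h1
  refine (Submodule.eq_bot_iff _).2 fun v hv => ?_
  have hw : mfderiv 𝓘(ℝ, EW) 𝓘(ℝ, EW) ψ' m v ∈ restrictDist (EW := EW) ι D (ψ' m) := by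
    have h4 : mfderiv 𝓘(ℝ, EW) I ι (ψ' m) (mfderiv 𝓘(ℝ, EW) 𝓘(ℝ, EW) ψ' m v) =
        mfderiv I I (Φ g⁻¹) (ι m) (mfderiv 𝓘(ℝ, EW) I ι m v) :=
      DFunLike.congr_fun (hasMFDerivAt_unique h1 h2) v
    have h5 : mfderiv I I (Φ g⁻¹) (ι m) (mfderiv 𝓘(ℝ, EW) I ι m v) ∈ D (Φ g⁻¹ (ι m)) := by
      rw [← hDG g⁻¹ m]
      exact Submodule.mem_map_of_mem hv
    -- All tangent spaces are definitionally `EP`, so equal base points give equal subspaces without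
    -- transport.
    have h6 : (D (ι (ψ' m)) : Submodule ℝ EP) = D (Φ g⁻¹ (ι m)) :=
      congrArg (β := Submodule ℝ EP) D (hψe' m)
    change mfderiv 𝓘(ℝ, EW) I ι (ψ' m) (mfderiv 𝓘(ℝ, EW) 𝓘(ℝ, EW) ψ' m v) ∈ D (ι (ψ' m))
    rw [h4]
    exact h6.symm ▸ h5
  rw [show restrictDist (EW := EW) ι D (ψ' m) = ⊥ from hn, Submodule.mem_bot] at hw
  have h7 : mfderiv 𝓘(ℝ, EW) 𝓘(ℝ, EW) ψ (ψ' m) (mfderiv 𝓘(ℝ, EW) 𝓘(ℝ, EW) ψ' m v) = v :=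
    DFunLike.congr_fun (hasMFDerivAt_unique h3 (hasMFDerivAt_id m)) v
  rw [← h7, hw]
  exact map_zero _

/-- Poisson reducibility implies the annihilator condition at points where `D` vanishes. -/
theorem bracket_eq_zero_of_isPoissonReducible [CompleteSpace EP] [FiniteDimensional ℝ EW]
    (hDG : IsGInvariantDistribution Φ ι D)
    (hreg : IsRegularDistribution (restrictDist (EW := EW) ι D))
    (hred : IsPoissonReducible (EW := EW) B Φ ι D) {n : W}
    (hn : restrictDist (EW := EW) ι D n = ⊥) {U : Set P} {f g : P → ℝ} (hnU : ι n ∈ U)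
    (hf : IsInvariantSmoothOn I Φ U f) (hfk : KillsOn ι D f univ U)
    (hg : IsInvariantSmoothOn I Φ U g) (hgk : KillsOn ι D g univ U) {c : ℝ}
    (hc : ∀ m, ι m ∈ U → g (ι m) = c) : B.bracket g f (ι n) = 0 := by
  have : CompleteSpace EW := FiniteDimensional.complete ℝ EW
  obtain ⟨O, hO, hOinv, hOA⟩ := R.exists_isOpen hreg.isClopen_eq_bot.isOpen
    (R.isGInvariantSet_eq_bot hDG)
  have hbot : ∀ {m}, ι m ∈ U ∩ O → restrictDist (EW := EW) ι D m = ⊥ := fun {m} hm =>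
    (hOA ▸ hm.2 : m ∈ {n | restrictDist (EW := EW) ι D n = ⊥})
  have hUO : IsOpen (U ∩ O) := hf.isOpen.inter hO
  have hUOinv := hf.invariant.inter hOinv
  have hleaf : ∀ {a b : W}, ι a ∈ U ∩ O → leafProj (restrictDist (EW := EW) ι D) a =
      leafProj (restrictDist ι D) b → a = b := fun ha hab => hreg.eq_of_leafProj_eq hab (hbot ha)
  have hflow : IsFlowInvariant (restrictDist (EW := EW) ι D) (ι ⁻¹' (U ∩ O)) :=
    fun a b hab ha => hleaf ha hab.leafProj_eq ▸ ha
  -- Leaves meeting `U ∩ O` are single points, so this set has preimage exactly `U ∩ O ∩ W` and is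
  -- open in the quotient.
  let V₀ : Set (LeafSpace (restrictDist (EW := EW) ι D)) :=
    leafProj (restrictDist ι D) '' (ι ⁻¹' (U ∩ O))
  have hpre : leafProj (restrictDist ι D) ⁻¹' V₀ = ι ⁻¹' (U ∩ O) := by
    refine Subset.antisymm ?_ (subset_preimage_image _ _)
    rintro b ⟨a, ha, hab⟩
    exact hleaf ha hab ▸ ha
  have hV : IsOpen V₀ ∧ IsGInvariantSet Φ (ι '' (leafProj (restrictDist ι D) ⁻¹' V₀)) := by
    rw [hpre]
    refine ⟨isOpen_coinduced.2 ?_, ?_⟩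
    · have h := hUO.preimage R.embedding.contMDiff.continuous
      rw [← hpre] at h
      exact h
    · rintro γ _ ⟨m, hm, rfl⟩
      obtain ⟨m', hm'⟩ := R.invariant γ (ι m) ⟨m, rfl⟩
      refine ⟨m', ?_, hm'⟩
      rw [mem_preimage, hm']
      exact hUOinv γ _ hm
  let V : InvOpens (EW := EW) Φ ι D := ⟨V₀, hV⟩
  choose r hr using fun x : V₀ => x.2
  have hext : ∀ F : P → ℝ, IsInvariantSmoothOn I Φ U F → KillsOn ι D F univ U →
      IsLocalInvariantExtension Φ ι D V₀ (fun x => F (ι (r x))) (U ∩ O) F := by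
    refine fun F hF hFk => ⟨⟨hF.mono inter_subset_left hUO hUOinv, hflow, fun m hm _ => ?_⟩,
      hFk.mono (fun _ _ _ => mem_univ _) inter_subset_left⟩
    exact congrArg (F ∘ ι) (hleaf (hr ⟨_, hm⟩).1 (hr ⟨_, hm⟩).2).symm
  have hmem : ∀ F : P → ℝ, IsInvariantSmoothOn I Φ U F → KillsOn ι D F univ U →
      (fun x : V₀ => F (ι (r x))) ∈ leafFunctions Φ ι D V₀ := by
    intro F hF hFk x hx
    exact ⟨r ⟨x, hx⟩, (hr ⟨x, hx⟩).2, U ∩ O, F, (hr ⟨x, hx⟩).1, (hext F hF hFk).1⟩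
  -- The decisive second extension: on `W` the function `g` equals `c`, so the constant extends the
  -- same function on the leaf space.
  have hconst : IsLocalInvariantExtension Φ ι D V₀ (fun x => g (ι (r x))) (U ∩ O) (fun _ => c) :=
    ⟨⟨.const hUO hUOinv c, hflow, fun m hm _ => (hc _ (hr ⟨_, hm⟩).1.1).symm⟩, .const c⟩
  have hnO : n ∈ ι ⁻¹' O := hOA ▸ hn
  have hnV : leafProj (restrictDist ι D) n ∈ V₀ := ⟨n, ⟨hnU, hnO⟩, rfl⟩
  obtain ⟨br, -, -, -, -, hbr⟩ := hred
  rw [← hbr V ⟨_, hmem g hg hgk⟩ ⟨_, hmem f hf hfk⟩ n hnV (U ∩ O) g f ⟨hnU, hnO⟩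
    (hext g hg hgk) (hext f hf hfk),
    hbr V ⟨_, hmem g hg hgk⟩ ⟨_, hmem f hf hfk⟩ n hnV (U ∩ O) (fun _ => c) f ⟨hnU, hnO⟩
    hconst (hext f hf hfk), B.bracket_const_left]

/-- Poisson reducibility is equivalent to the annihilator condition. -/
theorem isPoissonReducible_iff [IsManifold I ∞ P] [CompleteSpace EP] [FiniteDimensional ℝ EW]
    (hDG : IsGInvariantDistribution Φ ι D)
    (hreg : IsRegularDistribution (restrictDist (EW := EW) ι D)) :
    IsPoissonReducible (EW := EW) B Φ ι D ↔
      ∀ n : W, B.sharp (ι n) '' invCodist Φ ι D (ι n)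
        ⊆ annihilatorOf (invCodistConst Φ ι D (ι n)) := by
  refine ⟨fun hred n => ?_, R.isPoissonReducible⟩
  rintro _ ⟨_, ⟨U, f, hU, hf, hfk, rfl⟩, rfl⟩ _ ⟨U', g, hU', hg, hgk, ⟨c, hc⟩, rfl⟩
  have hf' := hf.mono inter_subset_left (hf.isOpen.inter hg.isOpen)
    (hf.invariant.inter hg.invariant)
  have hg' := hg.mono inter_subset_right (hf.isOpen.inter hg.isOpen)
    (hf.invariant.inter hg.invariant)
  have hfk' : KillsOn ι D f univ (U ∩ U') := hfk.mono (fun _ hm _ => hm) inter_subset_left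
  have hgk' : KillsOn ι D g univ (U ∩ U') := hgk.mono (fun _ hm _ => hm) inter_subset_right
  have hc' : ∀ m, ι m ∈ U ∩ U' → g (ι m) = c := fun m hm => hc m hm.2
  by_cases hn : restrictDist (EW := EW) ι D n = ⊥
  · exact R.bracket_eq_zero_of_isPoissonReducible (U := U ∩ U') hDG hreg hred hn ⟨hU, hU'⟩ hf' hfk'
      hg' hgk' hc'
  · refine R.canonical.bracket_eq_zero (fun h0 => hn ?_) hf'.isOpen ⟨hU, hU'⟩ hf'.smooth hfk'
      hg'.smooth hgk' hc'
    -- If `D` were zero at `ι n`, injectivity of `Tι` would make `D_W` zero at `n`.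
    refine (Submodule.eq_bot_iff _).2 fun v hv => ?_
    have hv' : mfderiv 𝓘(ℝ, EW) I ι n v ∈ D (ι n) := hv
    rw [h0, Submodule.mem_bot] at hv'
    exact mfderiv_injective_of_isImmersionAt (R.embedding.isImmersion.isImmersionAt n)
      (hv'.trans (map_zero _).symm)

end ReductionData

end General

section Cotangent

/-! ### The cotangent lifted action -/

variable {E : Type*} [NormedAddCommGroup E] [NormedSpace ℝ E]
  {Q : Type*} [TopologicalSpace Q] [ChartedSpace E Q]

/-- Fibres over different points are definitionally the same space, so covectors can be compared
there directly. -/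
theorem cotangentBundle_ext {x y : Q} (h : x = y) {A A' : E →L[ℝ] ℝ} (hA : A = A') :
    (⟨x, A⟩ : CotangentBundle E Q) = ⟨y, A'⟩ := by
  subst h hA
  rfl

variable {G : Type*} [Group G] [MulAction G Q]

variable (E) in
/-- The derivative of the action of `g` at `q`, as an endomorphism of the model space. -/
def smulDeriv (g : G) (q : Q) : E →L[ℝ] E :=
  mfderiv 𝓘(ℝ, E) 𝓘(ℝ, E) (fun q : Q => g • q) q

theorem smulDeriv_one (q : Q) : smulDeriv E (1 : G) q = ContinuousLinearMap.id ℝ E := by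
  have h : (fun q : Q => (1 : G) • q) = id := funext fun q => one_smul G q
  rw [smulDeriv, h]
  exact mfderiv_id

theorem smulDeriv_mul (hdiff : ∀ g : G, MDifferentiable 𝓘(ℝ, E) 𝓘(ℝ, E) fun q : Q => g • q)
    (g h : G) (q : Q) :
    smulDeriv E (g * h) q = (smulDeriv E g (h • q)).comp (smulDeriv E h q) := by
  have h1 : (fun q : Q => (g * h) • q) = (fun q : Q => g • q) ∘ fun q : Q => h • q :=
    funext fun q => mul_smul g h q
  rw [smulDeriv, h1]
  exact mfderiv_comp q (hdiff g (h • q)) (hdiff h q)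

/-- The inverse is the derivative of `g⁻¹` at `g • q`, by the chain rule in both orders. -/
theorem isInvertible_smulDeriv
    (hdiff : ∀ g : G, MDifferentiable 𝓘(ℝ, E) 𝓘(ℝ, E) fun q : Q => g • q) (g : G) (q : Q) :
    (smulDeriv E g q).IsInvertible := by
  refine .of_inverse (g := smulDeriv E g⁻¹ (g • q)) ?_ ?_
  · have h := smulDeriv_mul hdiff g g⁻¹ (g • q)
    rw [mul_inv_cancel, smulDeriv_one, inv_smul_smul] at h
    exact h.symm
  · rw [← smulDeriv_mul hdiff, inv_mul_cancel, smulDeriv_one]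

theorem cotangentLift_one (a : CotangentBundle E Q) : cotangentLift (1 : G) a = a := by
  refine cotangentBundle_ext (E := E)
    (A := (a.snd : E →L[ℝ] ℝ).comp (smulDeriv E (1 : G) a.proj).inverse) (A' := a.snd)
    (one_smul G a.proj) ?_
  rw [smulDeriv_one, ContinuousLinearMap.inverse_id]
  exact ContinuousLinearMap.comp_id (M₁ := E) (M₂ := ℝ) _

theorem cotangentLift_mul (hdiff : ∀ g : G, MDifferentiable 𝓘(ℝ, E) 𝓘(ℝ, E) fun q : Q => g • q)
    (g h : G) (a : CotangentBundle E Q) :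
    cotangentLift (g * h) a = cotangentLift g (cotangentLift h a) := by
  refine cotangentBundle_ext (E := E)
    (A := (a.snd : E →L[ℝ] ℝ).comp (smulDeriv E (g * h) a.proj).inverse)
    (A' := ((a.snd : E →L[ℝ] ℝ).comp (smulDeriv E h a.proj).inverse).comp
      (smulDeriv E g (h • a.proj)).inverse) (mul_smul g h a.proj) ?_
  -- `inverse` is `0` on non-invertible maps, so reversing it over a composition relies on
  -- invertibility of the outer derivative.
  rw [smulDeriv_mul hdiff, (isInvertible_smulDeriv hdiff g (h • a.proj)).inverse_comp_of_left]
  rfl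

end Cotangent

end CHSystems

end

/-! ### The theorem for symmetric CH systems -/

theorem theorem4p3
    {E : Type*} [NormedAddCommGroup E] [NormedSpace ℝ E] [FiniteDimensional ℝ E]
    {Q : Type*} [TopologicalSpace Q] [ChartedSpace E Q] [IsManifold 𝓘(ℝ, E) ∞ Q]
    [T2Space Q] [SecondCountableTopology Q]
    {EG : Type*} [NormedAddCommGroup EG] [NormedSpace ℝ EG] [FiniteDimensional ℝ EG]
    {G : Type*} [Group G] [TopologicalSpace G] [ChartedSpace EG G] [LieGroup 𝓘(ℝ, EG) ∞ G]
    [MulAction G Q] [ContMDiffSMul 𝓘(ℝ, EG) 𝓘(ℝ, E) ∞ G Q]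
    {EW : Type*} [NormedAddCommGroup EW] [NormedSpace ℝ EW] [FiniteDimensional ℝ EW]
    {W : Type*} [TopologicalSpace W] [ChartedSpace EW W] [IsManifold 𝓘(ℝ, EW) ∞ W] [T2Space W]
    (S : CHSystems.CHSystem E Q EW W) (hS : S.IsSymmetric G)
    (𝒜 : CHSystems.VerticalSplitting E Q)
    (hW : S.IsControllabilitySubmanifold 𝒜)
    (D : ∀ z : CHSystems.CotangentBundle E Q,
      Submodule ℝ (TangentSpace (CHSystems.cotModel E) z))
    (hD : S.IsControllabilityDistribution D)
    (hDG : CHSystems.IsGInvariantDistribution (CHSystems.cotangentLift (G := G)) S.ι D)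
    (hreg : CHSystems.IsRegularDistribution (CHSystems.restrictDist (EW := EW) S.ι D))
    (hext : CHSystems.HasLocalExtensionProperty (EW := EW)
      (CHSystems.cotangentLift (G := G)) S.ι D) :
    CHSystems.IsPoissonReducible (EW := EW) S.B (CHSystems.cotangentLift (G := G)) S.ι D ↔
      ∀ n : W,
        S.B.sharp (S.ι n) '' CHSystems.invCodist (CHSystems.cotangentLift (G := G)) S.ι D (S.ι n)
          ⊆ CHSystems.annihilatorOf
            (CHSystems.invCodistConst (CHSystems.cotangentLift (G := G)) S.ι D (S.ι n)) := by
  have : CompleteSpace E := FiniteDimensional.complete ℝ E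
  have hdiff : ∀ g : G, MDifferentiable 𝓘(ℝ, E) 𝓘(ℝ, E) fun q : Q => g • q := fun g =>
    (ContMDiffSMul.contMDiff_const_smul (I := 𝓘(ℝ, EG)) (n := ∞) g).mdifferentiable (by simp)
  have R : CHSystems.ReductionData (EW := EW) S.B
      (CHSystems.cotangentLift (E := E) (Q := Q) (G := G)) S.ι D :=
    ⟨CHSystems.cotangentLift_one, CHSystems.cotangentLift_mul hdiff, hS.poisson, S.ι_embedding,
      hS.W_inv, hD.2.2, hext⟩
  exact R.isPoissonReducible_iff hDG hreg
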